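/- A probability distribution $p$ on $[n]=\{1,\dots,n\}$ is non-increasing if $p(i+1)\le p(i)$ for all $i$; $d_{\mathrm{TV}}(p,q)=\frac12\sum_{i}|p(i)-q(i)|$. Let $\mathcal C$ be a class of distributions on $[n]$. A (randomized) identity tester on $\mathcal C$ with $m$ samples, distance parameter $\varepsilon$ and failure probability $\delta$ is an algorithm such that, for all $p,q\in\mathcal C$: if $p=q$ it accepts with probability at least $1-\delta$, and if $d_{\mathrm{TV}}(p,q)\ge\varepsilon$ it rejects with probability at least $1-\delta$. In the *known* case it is given $q$ explicitly and $m$ independent samples from $p$; in the *unknown* case it is given $m$ independent samples from $p$ and $m$ independent samples from $q$. For $\kappa>0$ let $\mathcal I_\kappa$ be Birgé's oblivious partition of $[n]$ into consecutive intervals $I_1,\dots,I_\ell$, where $|I_j|=\lfloor(1+\kappa)^j\rfloor$ for $j<\ell$, $\ell$ is the least integer with $\sum_{j\le\ell}\lfloor(1+\kappa)^j\rfloor\ge n$, and $I_\ell$ consists of the remaining points. The reduced distribution $p_r$ of $p$ is the distribution on $[\ell]$ with $p_r(j)=p(I_j)$. **Theorem.** There are absolute constants $c,C>0$ such that for all integers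 $n\ge 3$ and all $\varepsilon\in(0,1]$, $\delta\in(0,1)$, the partition $\mathcal I_{c\varepsilon}$ of $[n]$ has $$\ell\le C\,\frac{\log(\varepsilon n+1)}{\varepsilon}$$ intervals (in particular $\ell=O(\log n/\varepsilon)$), and the following hold. 1. ($q$ known.) For some $$m\le C\,(\log n)^{1/2}\,\log\log n\;\varepsilon^{-5/2}\,\log(1/\delta)$$ there is an identity tester $T$ with $m$ samples, for a known distribution, on the class of all distributions on $[\ell]$, with distance parameter $\varepsilon/2$ and failure probability $\delta$, such that the following is an identity tester with $m$ samples, for a known distribution, on the class of non-increasing distributions on $[n]$, with distance parameter $\varepsilon$ and failure probability $\delta$: replace each sample from $p$ by the index of the interval of $\mathcal I_{c\varepsilon}$ that contains it, replace $q$ by its reduced distribution $q_r$, and run $T$. 2. ($q$ unknown.) For some $$m\le C\,(\log n)^{2/3}\,\bigl(\log\log n+\log(1/\delta)\bigr)\,\varepsilon^{-10/3}$$ there is an identity tester $T$ with $m$ samples from each distribution, for two unknown distributions, on the class of all distributions on $[\ell]$, with distance parameter $\varepsilon/2$ and failure probability $\delta$, such that the following is an identity tester with $m$ samples from each distribution,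 for two unknown distributions, on the class of non-increasing distributions on $[n]$, with distance parameter $\varepsilon$ and failure probability $\delta$: replace each sample from $p$ and from $q$ by the index of the interval of $\mathcal I_{c\varepsilon}$ that contains it, and run $T$. In particular, for every fixed $\delta$, $O((\log n)^{1/2}\log\log n\cdot\varepsilon^{-5/2})$ samples suffice when $q$ is known, and $O((\log n)^{2/3}\log\log n\cdot\varepsilon^{-10/3})$ when $q$ is unknown. -/

import Mathlib

open scoped BigOperators

noncomputable section

/-! ### Distributions on `[n]` -/

/-- Probability distributions on `[n]`; the point `i ∈ {1, …, n}` is represented by the index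
`i - 1 : Fin n`. -/
abbrev FinDist (n : ℕ) : Type := stdSimplex ℝ (Fin n)

/-- Total variation distance, `d_TV(p, q) = (1/2) ∑ᵢ |p(i) - q(i)|`. -/
def tvDist {n : ℕ} (p q : FinDist n) : ℝ := (1 / 2) * ∑ i, |p i - q i|

/-- The class of non-increasing distributions on `[n]`. -/
def nonIncreasing (n : ℕ) : Set (FinDist n) := {p | Antitone (p : Fin n → ℝ)}

/-- The probability that `m` independent draws from `p` produce the sequence `x`. -/
def sampleProb {n m : ℕ} (p : FinDist n) (x : Fin m → Fin n) : ℝ := ∏ k, p (x k)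

/-! ### Testers -/

/-- A (randomized) identity tester with `m` samples, for a known distribution `q` on `[n]`:
given the explicit `q` and a sequence `x` of `m` samples of the unknown `p`,
it accepts with probability `T q x`, and otherwise rejects. -/
abbrev KnownTester (n m : ℕ) : Type := FinDist n → (Fin m → Fin n) → unitInterval

/-- A (randomized) identity tester for two unknown distributions on `[n]`: given a sequence `x` of
`m` samples of `p` and a sequence `y` of `m` samples of `q`,
it accepts with probability `T x y`, and otherwise rejects. -/
abbrev UnknownTester (n m : ℕ) : Type := (Fin m → Fin n) → (Fin m → Fin n) → unitInterval

/-- The probability, over `m` independent samples of `p` and the coins of the tester, that the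
tester accepts. -/
def KnownTester.acceptProb {n m : ℕ} (T : KnownTester n m) (p q : FinDist n) : ℝ :=
  ∑ x : Fin m → Fin n, sampleProb p x * (T q x : ℝ)

/-- The probability, over `m` independent samples of `p`, `m` independent samples of `q` and the
coins of the tester, that the tester accepts. -/
def UnknownTester.acceptProb {n m : ℕ} (T : UnknownTester n m) (p q : FinDist n) : ℝ :=
  ∑ x : Fin m → Fin n, ∑ y : Fin m → Fin n, sampleProb p x * sampleProb q y * (T x y : ℝ)

/-- If a test of the pair `p, q` accepts with probability `acc p q`, then it tests identity on the
class `𝒞` with distance parameter `ε` and failure probability `δ` when, for all `p, q` in `𝒞`: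
if `p = q` it accepts with probability at least `1 - δ`, and if `d_TV(p, q) ≥ ε` it rejects with
probability at least `1 - δ`. -/
def TestsIdentity {n : ℕ} (acc : FinDist n → FinDist n → ℝ) (𝒞 : Set (FinDist n)) (ε δ : ℝ) :
    Prop :=
  ∀ p ∈ 𝒞, ∀ q ∈ 𝒞,
    (p = q → 1 - δ ≤ acc p q) ∧ (ε ≤ tvDist p q → 1 - δ ≤ 1 - acc p q)

/-! ### Reduction to a smaller domain

A partition of `[n]` into `ℓ` labelled parts is given by the map `b : Fin n → Fin ℓ` that sends a
point to its part. The reduced distribution of `p`, which gives to a part its `p`-mass, is then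
`stdSimplex.map b p`. -/

/-- The tester on `[n]` that replaces each sample by the part containing it and the known `q` by
its reduced distribution, and then runs the tester `T` on `[ℓ]`. -/
def KnownTester.viaPartition {n ℓ m : ℕ} (b : Fin n → Fin ℓ) (T : KnownTester ℓ m) :
    KnownTester n m :=
  fun q x => T (stdSimplex.map b q) (b ∘ x)

/-- The tester on `[n]` that replaces each sample by the part containing it, and then runs the
tester `T` on `[ℓ]`. -/
def UnknownTester.viaPartition {n ℓ m : ℕ} (b : Fin n → Fin ℓ) (T : UnknownTester ℓ m) :
    UnknownTester n m :=
  fun x y => T (b ∘ x) (b ∘ y)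

/-! ### Birgé's oblivious partition

The consecutive intervals `I_1, I_2, …` of `[n]`, where `I_j` has `⌊(1 + κ) ^ j⌋` points and the
last interval is cut off at `n`. -/

/-- `birgeEnd κ j` is the number of points in the first `j` intervals (before the cut at `n`). -/
def birgeEnd (κ : ℝ) (j : ℕ) : ℕ := ∑ k ∈ Finset.Icc 1 j, ⌊(1 + κ) ^ k⌋₊

/-- The number of complete intervals that precede the point with index `i` (counted from `0`), that
is, the largest `j` with `birgeEnd κ j ≤ i`. (For `κ ≥ 0` we have `j ≤ birgeEnd κ j`, so that the
search may be bounded by `i`.) -/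
def birgeIndex (κ : ℝ) (i : ℕ) : ℕ := Nat.findGreatest (fun j => birgeEnd κ j ≤ i) i

/-- The number of intervals that are needed to cover `[n]`, for `n ≥ 1`. -/
def birgeCount (κ : ℝ) (n : ℕ) : ℕ := birgeIndex κ (n - 1) + 1

theorem birgeIndex_mono (κ : ℝ) {i j : ℕ} (h : i ≤ j) : birgeIndex κ i ≤ birgeIndex κ j :=
  Nat.findGreatest_mono (fun _ hk => le_trans hk h) h

/-- The map sending a point of `[n]` to its interval; the interval `I_j` has label `j - 1`. -/
def birgeMap (κ : ℝ) (n : ℕ) (i : Fin n) : Fin (birgeCount κ n) :=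
  ⟨birgeIndex κ i, Nat.lt_succ_of_le (birgeIndex_mono κ (Nat.le_sub_one_of_lt i.isLt))⟩

end

/-! The proof combines a reduction to a domain of size ℓ = O(log n / ε) with a tester that works for
arbitrary distributions on that domain.

Reduction. On an interval where p - q has constant sign, merging the points loses no ℓ¹ distance.
Otherwise the ranges of p and q overlap, and the loss is at most the length of the interval times
the sum of the two oscillations. A singleton loses nothing, and an interval with at least two points
has length at most 6κ times the number of points before it. By Abel summation, the sum over
intervals of (points before) · (oscillation) is at most the total mass 1, for p and for q. Hence the
total variation loss is at most 6κ (`tvDist_le_tvDist_map_birgeMap`), which is ε/2 for κ = ε/12.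

Tester. Let X and X' be the vectors of count differences of two independent batches of k sample
pairs, and let w be positive weights of total mass at most 1. The statistic ∑ XᵢX'ᵢ/wᵢ has mean k² ∑
(pᵢ - qᵢ)²/wᵢ, which is 0 if p = q and, by Cauchy–Schwarz, at least k² ‖p - q‖₁². Its variance is
governed by a bound B on ∑ (qᵢ/wᵢ)² and on all 1/wᵢ, and Chebyshev's inequality separates the two
cases once k is of order √B / ε² (`wprob_weightedStat_of_eq`, `wprob_weightedStat_of_far`). The
majority of O(log (1/δ)) rounds brings the error down to δ.

For known q, the average of q and the uniform distribution gives B of order ℓ, so ℓ^(1/2) / ε²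
samples per round. For unknown q, the weights are smoothed frequencies in about ℓ^(2/3) further
samples of q; this gives B of order ℓ^(4/3), so ℓ^(2/3) / ε² samples per round. Inserting ℓ = O(log
n / ε) gives slightly more than the theorem: no factor log log n is needed, and for unknown q the
power of ε is -8/3. -/

noncomputable section

/-! ### Finite probability spaces -/

section FiniteProbability

variable {Ω Ω' ι κ : Type*} [Fintype Ω] [Fintype Ω']

/-- The mean of `f` under the weights `π`. -/
def wmean (π f : Ω → ℝ) : ℝ := ∑ ω, π ω * f ω

/-- The product weights of independent draws, indexed by `ι`, from `π`. -/
def iidWeight (ι : Type*) [Fintype ι] (π : Ω → ℝ) (z : ι → Ω) : ℝ := ∏ i, π (z i)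

open Classical in
/-- The total weight of the event `A`. -/
def wprob (π : Ω → ℝ) (A : Ω → Prop) : ℝ := wmean π fun ω => if A ω then 1 else 0

theorem wmean_add (π f g : Ω → ℝ) : wmean π (fun ω => f ω + g ω) = wmean π f + wmean π g := by
  simp [wmean, mul_add, Finset.sum_add_distrib]

theorem wmean_sub (π f g : Ω → ℝ) : wmean π (fun ω => f ω - g ω) = wmean π f - wmean π g := by
  simp [wmean, mul_sub, Finset.sum_sub_distrib]

theorem wmean_const_mul (π : Ω → ℝ) (c : ℝ) (f : Ω → ℝ) :
    wmean π (fun ω => c * f ω) = c * wmean π f := by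
  simp only [wmean, Finset.mul_sum]
  exact Finset.sum_congr rfl fun _ _ => by ring

theorem wmean_sum {ι : Type*} (π : Ω → ℝ) (s : Finset ι) (f : ι → Ω → ℝ) :
    wmean π (fun ω => ∑ i ∈ s, f i ω) = ∑ i ∈ s, wmean π (f i) := by
  simp only [wmean, Finset.mul_sum]
  exact Finset.sum_comm

theorem wmean_const {π : Ω → ℝ} (hπ : π ∈ stdSimplex ℝ Ω) (c : ℝ) : wmean π (fun _ => c) = c := by
  simp [wmean, ← Finset.sum_mul, hπ.2]

theorem wmean_mono {π : Ω → ℝ} (hπ : π ∈ stdSimplex ℝ Ω) {f g : Ω → ℝ} (h : ∀ ω, f ω ≤ g ω) :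
    wmean π f ≤ wmean π g :=
  Finset.sum_le_sum fun ω _ => mul_le_mul_of_nonneg_left (h ω) (hπ.1 ω)

theorem wmean_comp_equiv (π : Ω → ℝ) (e : Ω' ≃ Ω) (f : Ω → ℝ) :
    wmean (fun ω => π (e ω)) (fun ω => f (e ω)) = wmean π f :=
  e.sum_comp fun ω => π ω * f ω

theorem wprob_le_of_imp {π : Ω → ℝ} (hπ : π ∈ stdSimplex ℝ Ω) {A B : Ω → Prop}
    (h : ∀ ω, A ω → B ω) : wprob π A ≤ wprob π B := by
  classical
  refine wmean_mono hπ fun ω => ?_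
  by_cases hA : A ω
  · simp [hA, h ω hA]
  · simp only [hA, if_false]; split_ifs <;> norm_num

theorem wprob_not {π : Ω → ℝ} (hπ : π ∈ stdSimplex ℝ Ω) (A : Ω → Prop) :
    wprob π (fun ω => ¬ A ω) = 1 - wprob π A := by
  classical
  rw [← wmean_const hπ 1, wprob, wprob, ← wmean_sub]
  refine congrArg _ (funext fun ω => ?_)
  by_cases hA : A ω <;> simp [hA]

theorem wprob_le_one {π : Ω → ℝ} (hπ : π ∈ stdSimplex ℝ Ω) (A : Ω → Prop) : wprob π A ≤ 1 := by
  classical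
  refine (wmean_mono hπ (g := fun _ => 1) fun ω => ?_).trans_eq (wmean_const hπ 1)
  split_ifs <;> norm_num

theorem wprob_nonneg {π : Ω → ℝ} (hπ : π ∈ stdSimplex ℝ Ω) (A : Ω → Prop) : 0 ≤ wprob π A := by
  have h := wprob_le_one hπ fun ω => ¬ A ω
  rw [wprob_not hπ] at h
  linarith

/-- Markov's inequality. -/
theorem wprob_le_div {π : Ω → ℝ} (hπ : π ∈ stdSimplex ℝ Ω) {A : Ω → Prop} {f : Ω → ℝ}
    (hf : ∀ ω, 0 ≤ f ω) {t : ℝ} (ht : 0 < t) (hA : ∀ ω, A ω → t ≤ f ω) :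
    wprob π A ≤ wmean π f / t := by
  classical
  rw [le_div_iff₀ ht, mul_comm, wprob, ← wmean_const_mul]
  refine wmean_mono hπ fun ω => ?_
  split_ifs with h
  · simpa using hA ω h
  · simpa using hf ω

variable [Fintype ι] [DecidableEq ι] [Fintype κ] [DecidableEq κ]

/-! ### Product weights and independent draws -/

theorem iidWeight_mem {π : Ω → ℝ} (hπ : π ∈ stdSimplex ℝ Ω) :
    iidWeight ι π ∈ stdSimplex ℝ (ι → Ω) := by
  refine ⟨fun z => Finset.prod_nonneg fun i _ => hπ.1 _, ?_⟩
  have := Finset.prod_univ_sum (fun _ : ι => (Finset.univ : Finset Ω)) fun _ => π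
  simp only [hπ.2, Finset.prod_const_one, Fintype.piFinset_univ] at this
  exact this.symm

theorem prod_mem_stdSimplex {π : Ω → ℝ} (hπ : π ∈ stdSimplex ℝ Ω) {π' : Ω' → ℝ}
    (hπ' : π' ∈ stdSimplex ℝ Ω') : (fun z : Ω × Ω' => π z.1 * π' z.2) ∈ stdSimplex ℝ (Ω × Ω') := by
  refine ⟨fun z => mul_nonneg (hπ.1 _) (hπ'.1 _), ?_⟩
  rw [Fintype.sum_prod_type]
  simp [← Finset.mul_sum, hπ.2, hπ'.2]

theorem wmean_prod (π : Ω → ℝ) (π' : Ω' → ℝ) (f : Ω × Ω' → ℝ) :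
    wmean (fun z : Ω × Ω' => π z.1 * π' z.2) f = wmean π fun a => wmean π' fun b => f (a, b) := by
  simp only [wmean, Fintype.sum_prod_type, Finset.mul_sum, mul_assoc]

theorem wmean_prod_fst (π : Ω → ℝ) {π' : Ω' → ℝ} (hπ' : π' ∈ stdSimplex ℝ Ω') (f : Ω → ℝ) :
    wmean (fun z : Ω × Ω' => π z.1 * π' z.2) (fun z => f z.1) = wmean π f := by
  rw [wmean_prod]; simp only [wmean_const hπ']

theorem wmean_prod_snd {π : Ω → ℝ} (hπ : π ∈ stdSimplex ℝ Ω) (π' : Ω' → ℝ) (f : Ω' → ℝ) :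
    wmean (fun z : Ω × Ω' => π z.1 * π' z.2) (fun z => f z.2) = wmean π' f := by
  rw [wmean_prod]; simp only [wmean_const hπ]

/-- Position 0 drives the inductions on the sample size; an arbitrary position expresses
exchangeability in `wmean_inv_count_add_one_le`. -/
theorem wmean_iidWeight_insertNth {k : ℕ} (s : Fin (k + 1)) (π : Ω → ℝ)
    (F : (Fin (k + 1) → Ω) → ℝ) :
    wmean (iidWeight (Fin (k + 1)) π) F =
      wmean π fun a => wmean (iidWeight (Fin k) π) fun z => F (s.insertNth a z) := by
  rw [← wmean_prod _ _ fun z : Ω × (Fin k → Ω) => F (s.insertNth z.1 z.2),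
    ← wmean_comp_equiv _ (Fin.insertNthEquiv (fun _ => Ω) s)]
  congr 1
  funext z
  simp [iidWeight, Fin.prod_univ_succAbove _ s]

theorem wmean_iidWeight_sum (π : Ω → ℝ) (F : (ι ⊕ κ → Ω) → ℝ) :
    wmean (iidWeight (ι ⊕ κ) π) F =
      wmean (iidWeight ι π) fun x => wmean (iidWeight κ π) fun y => F (Sum.elim x y) := by
  rw [← wmean_prod _ _ fun z : (ι → Ω) × (κ → Ω) => F (Sum.elim z.1 z.2),
    ← wmean_comp_equiv _ (Equiv.sumArrowEquivProdArrow ι κ Ω).symm]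
  congr 1
  funext z
  simp only [iidWeight, Fintype.prod_sum_type]
  rfl

theorem wmean_iidWeight_curry (π : Ω → ℝ) (F : (ι → κ → Ω) → ℝ) :
    wmean (iidWeight (ι × κ) π) (fun z => F (Function.curry z)) =
      wmean (iidWeight ι (iidWeight κ π)) F := by
  rw [← wmean_comp_equiv _ (Equiv.curry ι κ Ω)]
  congr 1
  funext z
  simp [iidWeight, Fintype.prod_prod_type, Function.curry]

theorem wmean_iidWeight_reindex (e : ι ≃ κ) (π : Ω → ℝ) (F : (ι → Ω) → ℝ) :
    wmean (iidWeight κ π) (fun z => F (z ∘ e)) = wmean (iidWeight ι π) F := by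
  rw [← wmean_comp_equiv _ (e.arrowCongr (Equiv.refl Ω)).symm]
  congr 1
  funext z
  exact (e.prod_comp fun i => π (z i)).symm

theorem wmean_iidWeight_pair (p : Ω → ℝ) (q : Ω' → ℝ)
    (F : (ι → Ω) → (ι → Ω') → ℝ) :
    wmean (iidWeight ι fun z : Ω × Ω' => p z.1 * q z.2)
        (fun z => F (fun i => (z i).1) fun i => (z i).2) =
      wmean (iidWeight ι p) fun x => wmean (iidWeight ι q) fun y => F x y := by
  rw [← wmean_prod _ _ fun z : (ι → Ω) × (ι → Ω') => F z.1 z.2,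
    ← wmean_comp_equiv _ (Equiv.arrowProdEquivProdArrow ι (fun _ => Ω) (fun _ => Ω'))]
  congr 1
  funext z
  simp [iidWeight, Finset.prod_mul_distrib]

theorem wmean_iidWeight_prod (π g : Ω → ℝ) :
    wmean (iidWeight ι π) (fun z => ∏ i, g (z i)) = wmean π g ^ Fintype.card ι := by
  have := Finset.prod_univ_sum (fun _ : ι => (Finset.univ : Finset Ω)) fun _ a => π a * g a
  simp only [Finset.prod_const, Fintype.piFinset_univ, Finset.card_univ] at this
  simp only [wmean, iidWeight, this, Finset.prod_mul_distrib]

/-! ### Moments and tails for sums of independent draws -/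

theorem wmean_iidWeight_sum_apply {π : Ω → ℝ} (hπ : π ∈ stdSimplex ℝ Ω) (f : Ω → ℝ) (k : ℕ) :
    wmean (iidWeight (Fin k) π) (fun z => ∑ s, f (z s)) = k * wmean π f := by
  induction k with
  | zero => simp [wmean]
  | succ k ih =>
    rw [wmean_iidWeight_insertNth 0]
    simp only [Fin.insertNth_zero', Fin.sum_univ_succ, Fin.cons_zero, Fin.cons_succ, wmean_add,
      wmean_const (iidWeight_mem hπ), ih, wmean_const hπ]
    push_cast; ring

theorem wmean_iidWeight_sq_sum_apply {π : Ω → ℝ} (hπ : π ∈ stdSimplex ℝ Ω) (f : Ω → ℝ) (k : ℕ) :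
    wmean (iidWeight (Fin k) π) (fun z => (∑ s, f (z s)) ^ 2) =
      k * (wmean π (fun a => f a ^ 2) - wmean π f ^ 2) + (k * wmean π f) ^ 2 := by
  induction k with
  | zero => simp [wmean]
  | succ k ih =>
    rw [wmean_iidWeight_insertNth 0]
    simp only [Fin.insertNth_zero', Fin.sum_univ_succ, Fin.cons_zero, Fin.cons_succ, add_sq,
      wmean_add, wmean_const (iidWeight_mem hπ), ih, wmean_const hπ, wmean_const_mul,
      wmean_iidWeight_sum_apply hπ]
    have (a : Ω) : 2 * f a * (k * wmean π f) = (2 * (k * wmean π f)) * f a := by ring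
    simp only [this, wmean_const_mul]
    push_cast; ring

theorem wmean_iidWeight_sq_sum_apply_le {π : Ω → ℝ} (hπ : π ∈ stdSimplex ℝ Ω) (f : Ω → ℝ)
    (k : ℕ) :
    wmean (iidWeight (Fin k) π) (fun z => (∑ s, f (z s)) ^ 2) ≤
      k * wmean π (fun a => f a ^ 2) + (k * wmean π f) ^ 2 := by
  rw [wmean_iidWeight_sq_sum_apply hπ]
  nlinarith [mul_nonneg (Nat.cast_nonneg (α := ℝ) k) (sq_nonneg (wmean π f))]

open Classical in
/-- An event of probability at most `1 / 10` occurs in at least half of the rounds only with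
exponentially small probability. -/
theorem wprob_majority_le {π : Ω → ℝ} (hπ : π ∈ stdSimplex ℝ Ω) {A : Ω → Prop}
    (hA : wprob π A ≤ 1 / 10) (r : ℕ) :
    wprob (iidWeight (Fin r) π) (fun z => r ≤ 2 * (Finset.univ.filter fun j => A (z j)).card) ≤
      (3 / 5) ^ r := by
  -- Chernoff bound: Markov's inequality for 9 ^ (number of occurrences) at level 3 ^ r. The mean is
  -- at most (1 + 8/10) ^ r, and (9/5)/3 = 3/5.
  have key := wprob_le_div (iidWeight_mem (ι := Fin r) hπ)
    (A := fun z : Fin r → Ω => r ≤ 2 * (Finset.univ.filter fun j => A (z j)).card)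
    (f := fun z => ∏ j, if A (z j) then (9 : ℝ) else 1) (t := 3 ^ r)
    (fun z => Finset.prod_nonneg fun j _ => by split_ifs <;> norm_num) (by positivity)
    (fun z hz => by
      rw [Finset.prod_ite, Finset.prod_const, Finset.prod_const_one, mul_one,
        show (9 : ℝ) = 3 ^ 2 by norm_num, ← pow_mul]
      exact pow_le_pow_right₀ (by norm_num) hz)
  have hmean : wmean π (fun ω => if A ω then (9 : ℝ) else 1) = 1 + 8 * wprob π A := by
    have (ω : Ω) : (if A ω then (9 : ℝ) else 1) = 1 + 8 * if A ω then 1 else 0 := by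
      split_ifs <;> norm_num
    simp only [this, wmean_add, wmean_const_mul, wmean_const hπ, wprob]
  rw [wmean_iidWeight_prod π fun ω => if A ω then (9 : ℝ) else 1, hmean, Fintype.card_fin,
    ← div_pow] at key
  refine key.trans (pow_le_pow_left₀ ?_ ?_ r)
  · have := wprob_nonneg hπ A
    positivity
  · linarith

open Classical in
/-- `(k + 1) π(A) E[1 / (N + 1)] ≤ 1`, where `N` counts the occurrences of `A` in `k` draws. -/
theorem wmean_inv_count_add_one_le {π : Ω → ℝ} (hπ : π ∈ stdSimplex ℝ Ω) (A : Ω → Prop) (k : ℕ) :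
    (k + 1) * wprob π A * wmean (iidWeight (Fin k) π)
      (fun z => 1 / (((Finset.univ.filter fun s => A (z s)).card : ℝ) + 1)) ≤ 1 := by
  set N : (Fin (k + 1) → Ω) → ℝ := fun z => ∑ s, if A (z s) then (1 : ℝ) else 0 with hN
  -- Among k + 1 draws, each occurrence of `A` gets the share 1/N. The expected share of draw s is
  -- the same for every s, and the shares add up to at most 1.
  have hs (s : Fin (k + 1)) :
      wmean (iidWeight (Fin (k + 1)) π) (fun z => (if A (z s) then 1 else 0) / N z) =
      wprob π A * wmean (iidWeight (Fin k) π)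
        (fun z => 1 / (((Finset.univ.filter fun s => A (z s)).card : ℝ) + 1)) := by
    rw [wmean_iidWeight_insertNth s, wprob, mul_comm, ← wmean_const_mul]
    refine congrArg _ (funext fun a => ?_)
    by_cases ha : A a
    · simp only [Fin.insertNth_apply_same, ha, if_true, mul_one]
      refine congrArg _ (funext fun z => ?_)
      simp [hN, Fin.sum_univ_succAbove _ s, ha, add_comm]
    · simp [ha, wmean]
  have hsum : wmean (iidWeight (Fin (k + 1)) π)
      (fun z => ∑ s, (if A (z s) then 1 else 0) / N z) ≤ 1 := by
    refine (wmean_mono (iidWeight_mem hπ) (g := fun _ => 1) fun z => ?_).trans_eq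
      (wmean_const (iidWeight_mem hπ) 1)
    rw [← Finset.sum_div]
    -- If `A` never occurs, the quotient is 0 / 0 = 0.
    exact div_self_le_one _
  rw [wmean_sum] at hsum
  simpa [hs, mul_assoc] using hsum

end FiniteProbability
/-! ### The weighted `ℓ²` statistic -/

section WeightedStatistic

variable {α : Type*} [Fintype α]

/-- The joint weights of a draw from `p` and an independent draw from `q`. -/
def pairWeight (p q : α → ℝ) (z : α × α) : ℝ := p z.1 * q z.2

theorem pairWeight_mem {p q : α → ℝ} (hp : p ∈ stdSimplex ℝ α) (hq : q ∈ stdSimplex ℝ α) :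
    pairWeight p q ∈ stdSimplex ℝ (α × α) :=
  prod_mem_stdSimplex hp hq

theorem wmean_pairWeight_sub {p q : α → ℝ} (hp : p ∈ stdSimplex ℝ α) (hq : q ∈ stdSimplex ℝ α)
    (c : α → ℝ) :
    wmean (pairWeight p q) (fun z => c z.1 - c z.2) = ∑ i, c i * (p i - q i) := by
  rw [wmean_sub]
  have h1 := wmean_prod_fst p hq c
  have h2 := wmean_prod_snd hp q c
  change wmean (pairWeight p q) _ = _ at h1
  change wmean (pairWeight p q) _ = _ at h2
  rw [h1, h2, wmean, wmean, ← Finset.sum_sub_distrib]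
  exact Finset.sum_congr rfl fun _ _ => by ring

theorem wmean_pairWeight_sq_sub_le {p q : α → ℝ} (hp : p ∈ stdSimplex ℝ α)
    (hq : q ∈ stdSimplex ℝ α) (c : α → ℝ) :
    wmean (pairWeight p q) (fun z => (c z.1 - c z.2) ^ 2) ≤ 2 * ∑ i, (p i + q i) * c i ^ 2 := by
  have h1 := wmean_prod_fst p hq fun a => c a ^ 2
  have h2 := wmean_prod_snd hp q fun a => c a ^ 2
  change wmean (pairWeight p q) _ = _ at h1
  change wmean (pairWeight p q) _ = _ at h2
  calc wmean (pairWeight p q) (fun z => (c z.1 - c z.2) ^ 2)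
      ≤ wmean (pairWeight p q) (fun z => 2 * c z.1 ^ 2 + 2 * c z.2 ^ 2) :=
        wmean_mono (pairWeight_mem hp hq) fun z => by nlinarith [sq_nonneg (c z.1 + c z.2)]
    _ = 2 * ∑ i, (p i + q i) * c i ^ 2 := by
        rw [wmean_add, wmean_const_mul, wmean_const_mul, h1, h2, wmean, wmean, ← mul_add,
          ← Finset.sum_add_distrib]
        exact congrArg _ (Finset.sum_congr rfl fun _ _ => by ring)

theorem wmean_sq_sum_sub_le {p q : α → ℝ} (hp : p ∈ stdSimplex ℝ α)
    (hq : q ∈ stdSimplex ℝ α) (c : α → ℝ) (k : ℕ) :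
    wmean (iidWeight (Fin k) (pairWeight p q))
        (fun z => (∑ s, (c (z s).1 - c (z s).2)) ^ 2) ≤
      k * (2 * ∑ i, (p i + q i) * c i ^ 2) + (k * ∑ i, c i * (p i - q i)) ^ 2 := by
  refine (wmean_iidWeight_sq_sum_apply_le (pairWeight_mem hp hq)
    (fun z => c z.1 - c z.2) k).trans ?_
  rw [wmean_pairWeight_sub hp hq]
  gcongr
  exact wmean_pairWeight_sq_sub_le hp hq c

theorem wmean_sum_sub {p q : α → ℝ} (hp : p ∈ stdSimplex ℝ α) (hq : q ∈ stdSimplex ℝ α) (c : α → ℝ) (k : ℕ) :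
    wmean (iidWeight (Fin k) (pairWeight p q)) (fun z => ∑ s, (c (z s).1 - c (z s).2)) =
      k * ∑ i, c i * (p i - q i) := by
  rw [wmean_iidWeight_sum_apply (pairWeight_mem hp hq) (fun z => c z.1 - c z.2) k,
    wmean_pairWeight_sub hp hq]

/-- The law of two independent batches. -/
def batchWeight (k : ℕ) (p q : α → ℝ) : (Fin k → α × α) × (Fin k → α × α) → ℝ := fun z =>
  iidWeight (Fin k) (pairWeight p q) z.1 * iidWeight (Fin k) (pairWeight p q) z.2

theorem batchWeight_mem {p q : α → ℝ} (hp : p ∈ stdSimplex ℝ α) (hq : q ∈ stdSimplex ℝ α) (k : ℕ) :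
    batchWeight k p q ∈ stdSimplex ℝ ((Fin k → α × α) × (Fin k → α × α)) :=
  prod_mem_stdSimplex (iidWeight_mem (pairWeight_mem hp hq))
    (iidWeight_mem (pairWeight_mem hp hq))

variable [DecidableEq α]

/-- The difference of the numbers of occurrences of `i` in the two samples. -/
def countDiff {k : ℕ} (z : Fin k → α × α) (i : α) : ℝ :=
  ∑ s, ((Pi.single i 1 : α → ℝ) (z s).1 - (Pi.single i 1 : α → ℝ) (z s).2)

/-- The weighted inner product of the count differences of two independent batches. -/
def weightedStat {k : ℕ} (w : α → ℝ) (z z' : Fin k → α × α) : ℝ :=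
  ∑ i, countDiff z i * countDiff z' i / w i

theorem sum_mul_countDiff {k : ℕ} (z : Fin k → α × α) (c : α → ℝ) :
    ∑ i, c i * countDiff z i = ∑ s, (c (z s).1 - c (z s).2) := by
  simp only [countDiff, Finset.mul_sum]
  rw [Finset.sum_comm]
  refine Finset.sum_congr rfl fun s _ => ?_
  simp [mul_sub, Pi.single_apply]

/-- For a fixed first batch, the statistic is a sum of independent terms over the second. Averaging
over the second batch leaves a sum of the same kind over the first, so both moments come from two
applications of the one-batch formulas. -/
theorem weightedStat_eq {k : ℕ} (w : α → ℝ) (z z' : Fin k → α × α) :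
    weightedStat w z z' =
      ∑ s, (countDiff z (z' s).1 / w (z' s).1 - countDiff z (z' s).2 / w (z' s).2) := by
  rw [← sum_mul_countDiff z' fun i => countDiff z i / w i]
  exact Finset.sum_congr rfl fun _ _ => by ring

variable {p q : α → ℝ}

theorem sum_countDiff_div_mul {k : ℕ} (w d : α → ℝ) (z : Fin k → α × α) :
    ∑ i, countDiff z i / w i * d i =
      ∑ s, (d (z s).1 / w (z s).1 - d (z s).2 / w (z s).2) := by
  rw [← sum_mul_countDiff z fun i => d i / w i]
  exact Finset.sum_congr rfl fun _ _ => by ring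

theorem wmean_weightedStat (hp : p ∈ stdSimplex ℝ α) (hq : q ∈ stdSimplex ℝ α) (w : α → ℝ)
    (k : ℕ) :
    wmean (iidWeight (Fin k) (pairWeight p q)) (fun z =>
      wmean (iidWeight (Fin k) (pairWeight p q)) fun z' => weightedStat w z z') =
      k ^ 2 * ∑ i, (p i - q i) ^ 2 / w i := by
  simp only [weightedStat_eq]
  have (z : Fin k → α × α) := wmean_sum_sub hp hq (fun i => countDiff z i / w i) k
  simp only [this, wmean_const_mul]
  simp only [sum_countDiff_div_mul w fun i => p i - q i]
  rw [wmean_sum_sub hp hq (fun i => (p i - q i) / w i) k, ← mul_assoc, ← sq]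
  exact congrArg _ (Finset.sum_congr rfl fun _ _ => by ring)

theorem wmean_sq_countDiff_le (hp : p ∈ stdSimplex ℝ α) (hq : q ∈ stdSimplex ℝ α) (i : α)
    (k : ℕ) :
    wmean (iidWeight (Fin k) (pairWeight p q)) (fun z => countDiff z i ^ 2) ≤
      k * (2 * (p i + q i)) + (k * (p i - q i)) ^ 2 := by
  refine (wmean_sq_sum_sub_le hp hq (Pi.single i 1) k).trans_eq ?_
  simp [Pi.single_apply]

theorem wmean_sq_weightedStat_le (hp : p ∈ stdSimplex ℝ α) (hq : q ∈ stdSimplex ℝ α)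
    (w : α → ℝ) (k : ℕ) :
    wmean (iidWeight (Fin k) (pairWeight p q)) (fun z =>
      wmean (iidWeight (Fin k) (pairWeight p q)) fun z' => weightedStat w z z' ^ 2) ≤
      4 * k ^ 2 * ∑ i, ((p i + q i) / w i) ^ 2 +
        4 * k ^ 3 * ∑ i, (p i + q i) * ((p i - q i) / w i) ^ 2 +
        (k ^ 2 * ∑ i, (p i - q i) ^ 2 / w i) ^ 2 := by
  have hmem := iidWeight_mem (ι := Fin k) (pairWeight_mem hp hq)
  -- Second moment over the second batch given the first: the variance part is quadratic in the
  -- count differences of `z`, the squared mean part is again the square of a sum over draws.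
  have hstep (z : Fin k → α × α) :
      wmean (iidWeight (Fin k) (pairWeight p q)) (fun z' => weightedStat w z z' ^ 2) ≤
        ∑ i, (2 * k * (p i + q i) / w i ^ 2) * countDiff z i ^ 2 +
          k ^ 2 * (∑ s, ((p (z s).1 - q (z s).1) / w (z s).1 -
            (p (z s).2 - q (z s).2) / w (z s).2)) ^ 2 := by
    simp only [weightedStat_eq]
    refine (wmean_sq_sum_sub_le hp hq (fun i => countDiff z i / w i) k).trans_eq ?_
    rw [sum_countDiff_div_mul w fun i => p i - q i, mul_pow]
    congr 1
    rw [Finset.mul_sum, Finset.mul_sum]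
    exact Finset.sum_congr rfl fun _ _ => by ring
  refine (wmean_mono hmem hstep).trans ?_
  rw [wmean_add, wmean_const_mul, wmean_sum]
  simp only [wmean_const_mul]
  have h1 : ∑ i, (2 * k * (p i + q i) / w i ^ 2) *
      wmean (iidWeight (Fin k) (pairWeight p q)) (fun z => countDiff z i ^ 2) ≤
      ∑ i, (2 * k * (p i + q i) / w i ^ 2) *
        (k * (2 * (p i + q i)) + (k * (p i - q i)) ^ 2) := by
    refine Finset.sum_le_sum fun i _ => mul_le_mul_of_nonneg_left
      (wmean_sq_countDiff_le hp hq i k) ?_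
    have := hp.1 i
    have := hq.1 i
    positivity
  have h2 := wmean_sq_sum_sub_le hp hq (fun i => (p i - q i) / w i) k
  refine (add_le_add h1 (mul_le_mul_of_nonneg_left h2 (sq_nonneg _))).trans_eq ?_
  have e1 : ∑ i, (2 * k * (p i + q i) / w i ^ 2) *
        (k * (2 * (p i + q i)) + (k * (p i - q i)) ^ 2) =
      4 * k ^ 2 * ∑ i, ((p i + q i) / w i) ^ 2 +
        2 * k ^ 3 * ∑ i, (p i + q i) * ((p i - q i) / w i) ^ 2 := by
    simp only [Finset.mul_sum, ← Finset.sum_add_distrib]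
    exact Finset.sum_congr rfl fun _ _ => by ring
  have e2 : ∑ i, (p i - q i) / w i * (p i - q i) = ∑ i, (p i - q i) ^ 2 / w i :=
    Finset.sum_congr rfl fun _ _ => by ring
  rw [e1, e2]
  ring

theorem variance_weightedStat_le (hp : p ∈ stdSimplex ℝ α) (hq : q ∈ stdSimplex ℝ α)
    (w : α → ℝ) (k : ℕ) :
    wmean (batchWeight k p q)
      (fun z => (weightedStat w z.1 z.2 - k ^ 2 * ∑ i, (p i - q i) ^ 2 / w i) ^ 2) ≤
      4 * k ^ 2 * ∑ i, ((p i + q i) / w i) ^ 2 +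
        4 * k ^ 3 * ∑ i, (p i + q i) * ((p i - q i) / w i) ^ 2 := by
  set m : ℝ := k ^ 2 * ∑ i, (p i - q i) ^ 2 / w i with hm
  have h1 : wmean (batchWeight k p q) (fun z => weightedStat w z.1 z.2) = m :=
    (wmean_prod _ _ fun z => weightedStat w z.1 z.2).trans (wmean_weightedStat hp hq w k)
  have h2 := (wmean_prod (iidWeight (Fin k) (pairWeight p q)) (iidWeight (Fin k) (pairWeight p q))
    fun z => weightedStat w z.1 z.2 ^ 2).trans_le (wmean_sq_weightedStat_le hp hq w k)
  change wmean (batchWeight k p q) _ ≤ _ at h2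
  have (z : (Fin k → α × α) × (Fin k → α × α)) : (weightedStat w z.1 z.2 - m) ^ 2 =
      weightedStat w z.1 z.2 ^ 2 - 2 * m * weightedStat w z.1 z.2 + m ^ 2 := by ring
  simp only [this, wmean_add, wmean_sub, wmean_const_mul, h1, wmean_const (batchWeight_mem hp hq k)]
  rw [← hm] at h2
  linarith

/-- When `p = q`, the weighted statistic is small with probability at least `19 / 20`. -/
theorem wprob_weightedStat_of_eq (hp : p ∈ stdSimplex ℝ α) {w : α → ℝ} {k : ℕ} {ε B : ℝ}
    (hε : 0 < ε) (hB : 0 < B) (hk : 1600000 * B ≤ k ^ 2 * ε ^ 4)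
    (hS : ∑ i, (p i / w i) ^ 2 ≤ B) :
    wprob (batchWeight k p p) (fun z => ¬ weightedStat w z.1 z.2 < k ^ 2 * ε ^ 2 / 2) ≤
      1 / 20 := by
  have hk0 : (0 : ℝ) < k ^ 2 := by
    by_contra h
    have : (k : ℝ) ^ 2 = 0 := le_antisymm (not_lt.1 h) (sq_nonneg _)
    rw [this] at hk; linarith
  have hv := variance_weightedStat_le hp hp w k
  simp only [sub_self, zero_div, ne_eq, OfNat.ofNat_ne_zero, not_false_eq_true, zero_pow, mul_zero,
    Finset.sum_const_zero, sub_zero, add_zero] at hv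
  have hF : ∑ i, ((p i + p i) / w i) ^ 2 = 4 * ∑ i, (p i / w i) ^ 2 := by
    rw [Finset.mul_sum]
    exact Finset.sum_congr rfl fun _ _ => by ring
  rw [hF] at hv
  have hpos : 0 < (k : ℝ) ^ 2 * ε ^ 2 / 2 := by positivity
  refine (wprob_le_div (batchWeight_mem hp hp k) (f := fun z => weightedStat w z.1 z.2 ^ 2)
    (fun _ => sq_nonneg _) (pow_pos hpos 2)
    fun z hz => pow_le_pow_left₀ hpos.le (not_lt.1 hz) 2).trans ?_
  rw [div_le_iff₀ (pow_pos hpos 2)]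
  nlinarith [mul_le_mul_of_nonneg_left hS hk0.le, mul_le_mul_of_nonneg_left hk hk0.le,
    mul_pos hk0 hB]

/-- When `p` and `q` are far apart, the weighted statistic is large with probability at least
`19 / 20`. -/
theorem wprob_weightedStat_of_far (hp : p ∈ stdSimplex ℝ α) (hq : q ∈ stdSimplex ℝ α)
    {w : α → ℝ} {k : ℕ} {ε B : ℝ} (hε : 0 < ε) (hε1 : ε ≤ 1) (hB : 0 < B)
    (hk : 1600000 * B ≤ k ^ 2 * ε ^ 4) (hw : ∀ i, 0 < w i) (hw1 : ∑ i, w i ≤ 1)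
    (hwB : ∀ i, 1 / w i ≤ B) (hS : ∑ i, (q i / w i) ^ 2 ≤ B) (hpq : ε ≤ ∑ i, |p i - q i|) :
    wprob (batchWeight k p q) (fun z => weightedStat w z.1 z.2 < k ^ 2 * ε ^ 2 / 2) ≤
      1 / 20 := by
  have hk0 : (0 : ℝ) < k ^ 2 := by
    by_contra h
    have : (k : ℝ) ^ 2 = 0 := le_antisymm (not_lt.1 h) (sq_nonneg _)
    rw [this] at hk; linarith
  have hkn : (0 : ℝ) ≤ k := Nat.cast_nonneg k
  set M : ℝ := ∑ i, (p i - q i) ^ 2 / w i with hM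
  set F2 : ℝ := ∑ i, ((p i + q i) / w i) ^ 2 with hF2
  set G : ℝ := ∑ i, (p i + q i) * ((p i - q i) / w i) ^ 2 with hG
  have hterm (i : α) : 0 ≤ (p i - q i) ^ 2 / w i := div_nonneg (sq_nonneg _) (hw i).le
  have hM0 : 0 ≤ M := Finset.sum_nonneg fun i _ => hterm i
  -- Cauchy–Schwarz, with |p i - q i| as the geometric mean of `w i` and (p i - q i)² / w i; this is
  -- where total weight at most 1 enters.
  have hMε : ε ^ 2 ≤ M := by
    have hcs := Finset.sum_sq_le_sum_mul_sum_of_sq_le_mul Finset.univ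
      (r := fun i => |p i - q i|) (f := w) (g := fun i => (p i - q i) ^ 2 / w i)
      (fun i _ => (hw i).le) (fun i _ => hterm i)
      (fun i _ => by
        have := (hw i).ne'
        rw [sq_abs]; field_simp; exact le_rfl)
    calc ε ^ 2 ≤ (∑ i, |p i - q i|) ^ 2 := pow_le_pow_left₀ hε.le hpq 2
      _ ≤ (∑ i, w i) * M := hcs
      _ ≤ M := by nlinarith
  have hMpos : 0 < M := (pow_pos hε 2).trans_le hMε
  -- Writing p + q = 2q + (p - q) leaves only q to be controlled by the weights; the rest is paid
  -- for by the mean `M` through 1/w ≤ B.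
  have hF2le : F2 ≤ 8 * B + 2 * B * M := by
    calc F2 ≤ ∑ i, (8 * (q i / w i) ^ 2 + 2 * B * ((p i - q i) ^ 2 / w i)) := by
          refine Finset.sum_le_sum fun i _ => ?_
          have h1 : ((p i + q i) / w i) ^ 2 ≤
              8 * (q i / w i) ^ 2 + 2 * ((p i - q i) / w i) ^ 2 := by
            have : (p i + q i) / w i = 2 * (q i / w i) + (p i - q i) / w i := by ring
            rw [this]
            nlinarith [sq_nonneg (2 * (q i / w i) - (p i - q i) / w i)]
          have h2 : ((p i - q i) / w i) ^ 2 ≤ B * ((p i - q i) ^ 2 / w i) := by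
            have : ((p i - q i) / w i) ^ 2 = 1 / w i * ((p i - q i) ^ 2 / w i) := by ring
            rw [this]
            exact mul_le_mul_of_nonneg_right (hwB i) (hterm i)
          linarith
      _ ≤ 8 * B + 2 * B * M := by
          rw [Finset.sum_add_distrib, ← Finset.mul_sum, ← Finset.mul_sum]
          linarith
  have hF20 : 0 ≤ F2 := Finset.sum_nonneg fun i _ => sq_nonneg _
  have hGle : G ^ 2 ≤ F2 * M ^ 2 := by
    have hcs := Finset.sum_mul_sq_le_sq_mul_sq Finset.univ (fun i => (p i + q i) / w i)
      (fun i => (p i - q i) ^ 2 / w i)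
    have hsq : ∑ i, ((p i - q i) ^ 2 / w i) ^ 2 ≤ M ^ 2 :=
      Finset.sum_sq_le_sq_sum_of_nonneg fun i _ => hterm i
    have hGeq : G = ∑ i, (p i + q i) / w i * ((p i - q i) ^ 2 / w i) :=
      Finset.sum_congr rfl fun _ _ => by ring
    rw [hGeq]
    exact hcs.trans (mul_le_mul_of_nonneg_left hsq hF20)
  -- `B` and `B * M` are both small compared with `(k * M) ^ 2`
  have hBk : 1600000 * B ≤ (k * M) ^ 2 := by
    refine hk.trans ?_
    rw [mul_pow]
    refine mul_le_mul_of_nonneg_left ?_ hk0.le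
    calc ε ^ 4 = (ε ^ 2) ^ 2 := by ring
      _ ≤ M ^ 2 := pow_le_pow_left₀ (sq_nonneg _) hMε 2
  have hBMk : 1600000 * (B * M) ≤ (k * M) ^ 2 := by
    have hε4 : ε ^ 4 ≤ M := by
      refine le_trans ?_ hMε
      exact pow_le_pow_of_le_one hε.le hε1 (by norm_num)
    calc 1600000 * (B * M) = 1600000 * B * M := by ring
      _ ≤ k ^ 2 * ε ^ 4 * M := mul_le_mul_of_nonneg_right hk hM0
      _ ≤ k ^ 2 * M * M := by gcongr
      _ = (k * M) ^ 2 := by ring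
  have hF2k : F2 ≤ (k * M / 400) ^ 2 := by
    have : (k * M / 400) ^ 2 = (k * M) ^ 2 / 160000 := by ring
    rw [this]; linarith
  have hkG : k ^ 3 * G ≤ (k ^ 2 * M) ^ 2 / 400 := by
    have hG2 : G ^ 2 ≤ (k * M ^ 2 / 400) ^ 2 := by
      calc G ^ 2 ≤ F2 * M ^ 2 := hGle
        _ ≤ (k * M / 400) ^ 2 * M ^ 2 := mul_le_mul_of_nonneg_right hF2k (sq_nonneg _)
        _ = (k * M ^ 2 / 400) ^ 2 := by ring
    have hG3 : G ≤ k * M ^ 2 / 400 :=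
      (le_abs_self G).trans (abs_le_of_sq_le_sq hG2 (by positivity))
    calc (k : ℝ) ^ 3 * G ≤ k ^ 3 * (k * M ^ 2 / 400) :=
          mul_le_mul_of_nonneg_left hG3 (by positivity)
      _ = (k ^ 2 * M) ^ 2 / 400 := by ring
  have hv := variance_weightedStat_le hp hq w k
  rw [← hM, ← hF2, ← hG] at hv
  have hpos : 0 < (k : ℝ) ^ 2 * M / 2 := by positivity
  refine (wprob_le_div (batchWeight_mem hp hq k)
    (f := fun z => (weightedStat w z.1 z.2 - k ^ 2 * M) ^ 2)
    (fun _ => sq_nonneg _) (pow_pos hpos 2) fun z hz => ?_).trans ?_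
  -- The threshold is at most half the mean, so a value below it deviates by at least k²M/2.
  · have : (k : ℝ) ^ 2 * ε ^ 2 ≤ k ^ 2 * M := by gcongr
    nlinarith
  · rw [div_le_iff₀ (pow_pos hpos 2)]
    refine hv.trans ?_
    have : (k : ℝ) ^ 2 * F2 ≤ (k ^ 2 * M) ^ 2 / 160000 := by
      calc (k : ℝ) ^ 2 * F2 ≤ k ^ 2 * (k * M / 400) ^ 2 :=
            mul_le_mul_of_nonneg_left hF2k hk0.le
        _ = _ := by ring
    -- 4/160000 + 4/400 is below 1/80 = (1/2)²/20.
    nlinarith [sq_nonneg ((k : ℝ) ^ 2 * M)]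

end WeightedStatistic
/-! ### The amplified closeness test -/

section ClosenessTest

variable {α : Type*} [Fintype α]

/-- The index set of the samples of one round: the first block determines the weights, the other
two blocks are the batches of the weighted statistic. -/
abbrev RoundIndex (k₀ k : ℕ) : Type := Fin k₀ ⊕ (Fin k ⊕ Fin k)

theorem wmean_roundIndex {k₀ k : ℕ} (p q : α → ℝ)
    (F : (Fin k₀ → α × α) → (Fin k → α × α) → (Fin k → α × α) → ℝ) :
    wmean (iidWeight (RoundIndex k₀ k) (pairWeight p q))
        (fun z => F (fun s => z (Sum.inl s)) (fun s => z (Sum.inr (Sum.inl s)))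
          fun s => z (Sum.inr (Sum.inr s))) =
      wmean (iidWeight (Fin k₀) (pairWeight p q)) fun u =>
        wmean (batchWeight k p q) fun z => F u z.1 z.2 := by
  rw [wmean_iidWeight_sum]
  refine congrArg _ (funext fun u => ?_)
  simp only [Sum.elim_inl, Sum.elim_inr]
  rw [wmean_iidWeight_sum]
  exact (wmean_prod _ _ fun z : (Fin k → α × α) × (Fin k → α × α) => F u z.1 z.2).symm

theorem wmean_iidWeight_pairWeight_snd {k₀ : ℕ} {p q : α → ℝ} (hp : p ∈ stdSimplex ℝ α)
    (F : (Fin k₀ → α) → ℝ) :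
    wmean (iidWeight (Fin k₀) (pairWeight p q)) (fun u => F fun s => (u s).2) =
      wmean (iidWeight (Fin k₀) q) F := by
  refine (wmean_iidWeight_pair p q fun _ y => F y).trans ?_
  exact wmean_const (iidWeight_mem hp) _

variable {k₀ k : ℕ} {w : (Fin k₀ → α) → α → ℝ} {ε B : ℝ} {p q : α → ℝ}

-- The two sources of error, bad weights (by Markov's inequality) and a bad statistic for good
-- weights, cost 1/20 each. The weights depend only on the first block, which is independent of the
-- batches.
open Classical in
theorem wprob_round_le (hp : p ∈ stdSimplex ℝ α) (hq : q ∈ stdSimplex ℝ α) (hB : 0 < B)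
    (hS : wmean (iidWeight (Fin k₀) q) (fun y => ∑ i, (q i / w y i) ^ 2) ≤ B / 20)
    (E : (α → ℝ) → (Fin k → α × α) → (Fin k → α × α) → Prop)
    (hE : ∀ y, ∑ i, (q i / w y i) ^ 2 ≤ B →
      wprob (batchWeight k p q) (fun z => E (w y) z.1 z.2) ≤ 1 / 20) :
    wprob (iidWeight (RoundIndex k₀ k) (pairWeight p q))
      (fun z => E (w fun s => (z (Sum.inl s)).2) (fun s => z (Sum.inr (Sum.inl s)))
        fun s => z (Sum.inr (Sum.inr s))) ≤ 1 / 10 := by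
  rw [wprob, wmean_roundIndex p q fun u z z' => if E (w fun s => (u s).2) z z' then (1 : ℝ) else 0,
    wmean_iidWeight_pairWeight_snd hp fun y =>
      wmean (batchWeight k p q) fun z => if E (w y) z.1 z.2 then (1 : ℝ) else 0]
  -- The last term exceeds 1 for bad weights, so one inequality covers both cases and can be
  -- averaged.
  have hle (y : Fin k₀ → α) :
      wmean (batchWeight k p q) (fun z => if E (w y) z.1 z.2 then (1 : ℝ) else 0) ≤
        1 / 20 + 1 / B * ∑ i, (q i / w y i) ^ 2 := by
    have hnn : 0 ≤ ∑ i, (q i / w y i) ^ 2 := Finset.sum_nonneg fun i _ => sq_nonneg _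
    by_cases h : ∑ i, (q i / w y i) ^ 2 ≤ B
    · exact (hE y h).trans (le_add_of_nonneg_right (by positivity))
    · have h1 := wprob_le_one (batchWeight_mem hp hq k) fun z => E (w y) z.1 z.2
      have h2 : 1 ≤ 1 / B * ∑ i, (q i / w y i) ^ 2 := by
        rw [one_div_mul_eq_div, le_div_iff₀ hB]
        linarith
      exact h1.trans (by linarith)
  refine (wmean_mono (iidWeight_mem hq) hle).trans ?_
  rw [wmean_add, wmean_const_mul, wmean_const (iidWeight_mem hq), one_div_mul_eq_div]
  have : wmean (iidWeight (Fin k₀) q) (fun y => ∑ i, (q i / w y i) ^ 2) / B ≤ 1 / 20 := by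
    rw [div_le_iff₀ hB]
    linarith
  linarith

variable [DecidableEq α]

/-- One round accepts when the weighted statistic is below the threshold. -/
def RoundAccepts {k₀ k : ℕ} (w : (Fin k₀ → α) → α → ℝ) (τ : ℝ)
    (z : RoundIndex k₀ k → α × α) : Prop :=
  weightedStat (w fun s => (z (Sum.inl s)).2) (fun s => z (Sum.inr (Sum.inl s)))
    (fun s => z (Sum.inr (Sum.inr s))) < τ

open Classical in
/-- The majority of the rounds accepts. -/
def MajorityAccepts {k₀ k r : ℕ} (w : (Fin k₀ → α) → α → ℝ) (τ : ℝ)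
    (v : Fin r → RoundIndex k₀ k → α × α) : Prop :=
  r < 2 * (Finset.univ.filter fun j => RoundAccepts w τ (v j)).card

theorem wprob_majority_of_eq (hp : p ∈ stdSimplex ℝ α) (hε : 0 < ε) (hB : 0 < B)
    (hk : 1600000 * B ≤ k ^ 2 * ε ^ 4)
    (hS : wmean (iidWeight (Fin k₀) p) (fun y => ∑ i, (p i / w y i) ^ 2) ≤ B / 20) (r : ℕ) :
    wprob (iidWeight (Fin r) (iidWeight (RoundIndex k₀ k) (pairWeight p p)))
      (fun v => ¬ MajorityAccepts w (k ^ 2 * ε ^ 2 / 2) v) ≤ (3 / 5) ^ r := by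
  classical
  have hmem := iidWeight_mem (ι := RoundIndex k₀ k) (pairWeight_mem hp hp)
  refine (wprob_le_of_imp (iidWeight_mem hmem) fun v hv => ?_).trans
    (wprob_majority_le hmem (A := fun z => ¬ RoundAccepts w (k ^ 2 * ε ^ 2 / 2) z)
      (wprob_round_le hp hp hB hS (fun w z z' => ¬ weightedStat w z z' < k ^ 2 * ε ^ 2 / 2)
        fun y hy => wprob_weightedStat_of_eq hp hε hB hk hy) r)
  have hcard := Finset.card_filter_add_card_filter_not (s := (Finset.univ : Finset (Fin r)))
    fun j => RoundAccepts w (k ^ 2 * ε ^ 2 / 2) (v j)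
  rw [Finset.card_univ, Fintype.card_fin] at hcard
  unfold MajorityAccepts at hv
  have e1 : (Finset.univ.filter fun j => RoundAccepts w (k ^ 2 * ε ^ 2 / 2) (v j)).card ≤ r / 2 := by
    omega
  convert (show r ≤ 2 * (Finset.univ.filter fun j =>
    ¬ RoundAccepts w (k ^ 2 * ε ^ 2 / 2) (v j)).card by omega)

theorem wprob_majority_of_far (hp : p ∈ stdSimplex ℝ α) (hq : q ∈ stdSimplex ℝ α) (hε : 0 < ε)
    (hε1 : ε ≤ 1) (hB : 0 < B) (hk : 1600000 * B ≤ k ^ 2 * ε ^ 4) (hw : ∀ y i, 0 < w y i)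
    (hw1 : ∀ y, ∑ i, w y i ≤ 1) (hwB : ∀ y i, 1 / w y i ≤ B)
    (hS : wmean (iidWeight (Fin k₀) q) (fun y => ∑ i, (q i / w y i) ^ 2) ≤ B / 20)
    (hpq : ε ≤ ∑ i, |p i - q i|) (r : ℕ) :
    wprob (iidWeight (Fin r) (iidWeight (RoundIndex k₀ k) (pairWeight p q)))
      (fun v => MajorityAccepts w (k ^ 2 * ε ^ 2 / 2) v) ≤ (3 / 5) ^ r := by
  classical
  have hmem := iidWeight_mem (ι := RoundIndex k₀ k) (pairWeight_mem hp hq)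
  refine (wprob_le_of_imp (iidWeight_mem hmem) fun v hv => ?_).trans
    (wprob_majority_le hmem (A := fun z => RoundAccepts w (k ^ 2 * ε ^ 2 / 2) z)
      (wprob_round_le hp hq hB hS (fun w z z' => weightedStat w z z' < k ^ 2 * ε ^ 2 / 2)
        fun y hy => wprob_weightedStat_of_far hp hq hε hε1 hB hk (hw y) (hw1 y) (hwB y) hy hpq) r)
  exact hv.le

open Classical in
/-- A closeness test with data-dependent weights: it errs with probability at most `(3 / 5) ^ r`. -/
theorem exists_closeness_test {k₀ k m : ℕ} (r : ℕ) (hm : r * (k₀ + (k + k)) = m)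
    (w : (Fin k₀ → α) → α → ℝ) (hε : 0 < ε) (hε1 : ε ≤ 1) (hB : 0 < B)
    (hk : 1600000 * B ≤ k ^ 2 * ε ^ 4) (hw : ∀ y i, 0 < w y i) (hw1 : ∀ y, ∑ i, w y i ≤ 1)
    (hwB : ∀ y i, 1 / w y i ≤ B) :
    ∃ A : (Fin m → α) → (Fin m → α) → Prop, ∀ p ∈ stdSimplex ℝ α, ∀ q ∈ stdSimplex ℝ α,
      wmean (iidWeight (Fin k₀) q) (fun y => ∑ i, (q i / w y i) ^ 2) ≤ B / 20 →
      (p = q → 1 - (3 / 5) ^ r ≤ wmean (iidWeight (Fin m) p) fun x =>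
        wmean (iidWeight (Fin m) q) fun y => if A x y then 1 else 0) ∧
      (ε ≤ ∑ i, |p i - q i| → (wmean (iidWeight (Fin m) p) fun x =>
        wmean (iidWeight (Fin m) q) fun y => if A x y then 1 else 0) ≤ (3 / 5) ^ r) := by
  -- Any distribution of the m sample positions over rounds and blocks will do, since the draws are
  -- i.i.d.
  have e : Fin r × RoundIndex k₀ k ≃ Fin m :=
    Fintype.equivFinOfCardEq (by simp [RoundIndex, hm])
  set τ : ℝ := k ^ 2 * ε ^ 2 / 2 with hτ
  refine ⟨fun x y => MajorityAccepts (k₀ := k₀) (k := k) (r := r) w τ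
    fun i j => (x (e (i, j)), y (e (i, j))), fun p hp q hq hS => ?_⟩
  have key : (wmean (iidWeight (Fin m) p) fun x => wmean (iidWeight (Fin m) q) fun y =>
      if MajorityAccepts (k₀ := k₀) (k := k) (r := r) w τ
        (fun i j => (x (e (i, j)), y (e (i, j)))) then (1 : ℝ) else 0) =
      wprob (iidWeight (Fin r) (iidWeight (RoundIndex k₀ k) (pairWeight p q)))
        (fun v => MajorityAccepts w τ v) := by
    rw [wprob, ← wmean_iidWeight_curry, ← wmean_iidWeight_reindex e]
    exact (wmean_iidWeight_pair p q fun x y =>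
      if MajorityAccepts (k₀ := k₀) (k := k) (r := r) w τ
        (fun i j => (x (e (i, j)), y (e (i, j)))) then (1 : ℝ) else 0).symm
  rw [key]
  refine ⟨?_, fun hpq => wprob_majority_of_far hp hq hε hε1 hB hk hw hw1 hwB hS hpq r⟩
  rintro rfl
  have := wprob_majority_of_eq hp hε hB hk hS r
  rw [wprob_not (iidWeight_mem (iidWeight_mem (pairWeight_mem hp hp)))] at this
  linarith

end ClosenessTest
/-! ### Identity testers on the reduced domain -/

theorem exists_rounds {δ : ℝ} (hδ : 0 < δ) (hδ1 : δ < 1 / 2) :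
    ∃ r : ℕ, (3 / 5 : ℝ) ^ r ≤ δ ∧ (r : ℝ) ≤ 5 * Real.log (1 / δ) := by
  have hlog : (1 / 2 : ℝ) ≤ Real.log (1 / δ) := by
    have h2 : (2 : ℝ) ≤ 1 / δ := by rw [le_div_iff₀ hδ]; linarith
    have := Real.log_le_log (by norm_num) h2
    linarith [Real.log_two_gt_d9]
  -- log (3/5) ≤ -2/5 and 3 · 2/5 > 1; rounding up costs 1 ≤ 2 log (1/δ).
  refine ⟨⌈3 * Real.log (1 / δ)⌉₊, ?_, ?_⟩
  · have hr := Nat.le_ceil (3 * Real.log (1 / δ))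
    set r : ℕ := ⌈3 * Real.log (1 / δ)⌉₊
    rw [← Real.log_le_log_iff (by positivity) hδ, Real.log_pow]
    have h1 : Real.log (3 / 5) ≤ 3 / 5 - 1 := Real.log_le_sub_one_of_pos (by norm_num)
    rw [one_div δ, Real.log_inv] at hr hlog
    nlinarith [Nat.cast_nonneg (α := ℝ) r]
  · have := Nat.ceil_lt_add_one (show 0 ≤ 3 * Real.log (1 / δ) by linarith)
    linarith

theorem exists_batch_size {X ε : ℝ} (hX : 1 ≤ X) (hε : 0 < ε) (hε1 : ε ≤ 1) :
    ∃ k : ℕ, 1600000 * (80 * X ^ 2) ≤ (k : ℝ) ^ 2 * ε ^ 4 ∧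
      (k : ℝ) ≤ 12001 * (X * ε ^ (-2 : ℝ)) := by
  have hε2 : ε ^ (-2 : ℝ) = (ε ^ 2)⁻¹ := by
    rw [Real.rpow_neg hε.le]; norm_cast
  have hinv : 1 ≤ (ε ^ 2)⁻¹ := (one_le_inv₀ (by positivity)).2 (pow_le_one₀ hε.le hε1)
  have hone : 1 ≤ X * (ε ^ 2)⁻¹ := one_le_mul_of_one_le_of_one_le hX hinv
  rw [hε2]
  refine ⟨⌈12000 * (X * (ε ^ 2)⁻¹)⌉₊, ?_, ?_⟩
  · have hk := Nat.le_ceil (12000 * (X * (ε ^ 2)⁻¹))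
    set k : ℕ := ⌈12000 * (X * (ε ^ 2)⁻¹)⌉₊
    have h1 : 12000 * X ≤ k * ε ^ 2 := by
      rw [← mul_assoc, ← div_eq_mul_inv, div_le_iff₀ (by positivity)] at hk
      exact hk
    calc 1600000 * (80 * X ^ 2) ≤ (12000 * X) ^ 2 := by nlinarith [sq_nonneg X]
      _ ≤ (k * ε ^ 2) ^ 2 := pow_le_pow_left₀ (by positivity) h1 2
      _ = (k : ℝ) ^ 2 * ε ^ 4 := by ring
  · have := Nat.ceil_lt_add_one (show 0 ≤ 12000 * (X * (ε ^ 2)⁻¹) by positivity)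
    linarith

theorem FinDist.coe_mem {n : ℕ} (p : FinDist n) : ⇑p ∈ stdSimplex ℝ (Fin n) :=
  p.2

theorem KnownTester.acceptProb_eq_wmean {n m : ℕ} (T : KnownTester n m) (p q : FinDist n) :
    T.acceptProb p q = wmean (iidWeight (Fin m) p) fun x => (T q x : ℝ) :=
  rfl

theorem UnknownTester.acceptProb_eq_wmean {n m : ℕ} (T : UnknownTester n m) (p q : FinDist n) :
    T.acceptProb p q = wmean (iidWeight (Fin m) p) fun x =>
      wmean (iidWeight (Fin m) q) fun y => (T x y : ℝ) := by
  simp only [UnknownTester.acceptProb, wmean, Finset.mul_sum, mul_assoc]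
  rfl

/-- A fair coin is enough for δ ≥ 1/2. The case is treated apart because log (1/δ) tends to 0 as δ
tends to 1, and then the bound leaves no room for a single sample. -/
theorem testsIdentity_of_half_le {n : ℕ} {acc : FinDist n → FinDist n → ℝ}
    (hacc : ∀ p q, acc p q = 1 / 2) (𝒞 : Set (FinDist n)) (ε : ℝ) {δ : ℝ} (hδ : 1 / 2 ≤ δ) :
    TestsIdentity acc 𝒞 ε δ := fun p _ q _ => by
  rw [hacc]
  exact ⟨fun _ => by linarith, fun _ => by linarith⟩

/-- The acceptance probability `1 / 2`. -/
def halfAccept : unitInterval := ⟨1 / 2, by norm_num, by norm_num⟩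

theorem le_sum_abs_of_le_tvDist {n : ℕ} {p q : FinDist n} {ε : ℝ} (h : ε / 2 ≤ tvDist p q) :
    ε ≤ ∑ i, |p i - q i| := by
  unfold tvDist at h
  linarith

theorem exists_knownTester {ℓ : ℕ} (hℓ : 1 ≤ ℓ) {ε δ : ℝ} (hε : 0 < ε) (hε1 : ε ≤ 1)
    (hδ : 0 < δ) (hδ1 : δ < 1) :
    ∃ m : ℕ, (m : ℝ) ≤ 130000 * ((ℓ : ℝ) ^ (1 / 2 : ℝ) * ε ^ (-2 : ℝ) * Real.log (1 / δ)) ∧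
      ∃ T : KnownTester ℓ m, TestsIdentity T.acceptProb Set.univ (ε / 2) δ := by
  classical
  have hℓ1 : (1 : ℝ) ≤ ℓ := by exact_mod_cast hℓ
  have hlog0 : 0 ≤ Real.log (1 / δ) := Real.log_nonneg (by rw [le_div_iff₀ hδ]; linarith)
  rcases le_or_gt (1 / 2) δ with hδ2 | hδ2
  · refine ⟨0, by rw [Nat.cast_zero]; positivity, fun _ _ => halfAccept,
      testsIdentity_of_half_le (fun p q => ?_) _ _ hδ2⟩
    exact wmean_const (iidWeight_mem (FinDist.coe_mem p)) (1 / 2)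
  obtain ⟨r, hr, hr'⟩ := exists_rounds hδ hδ2
  have hX1 : 1 ≤ (ℓ : ℝ) ^ (1 / 2 : ℝ) := Real.one_le_rpow hℓ1 (by norm_num)
  have hX2 : ((ℓ : ℝ) ^ (1 / 2 : ℝ)) ^ 2 = ℓ := by
    rw [← Real.rpow_natCast, ← Real.rpow_mul (by positivity)]; norm_num
  obtain ⟨k, hk, hk'⟩ := exists_batch_size hX1 hε hε1
  rw [hX2] at hk
  have hw (q : FinDist ℓ) (i : Fin ℓ) : 0 < (q i + 1 / (ℓ : ℝ)) / 2 := by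
    have := stdSimplex.zero_le q i
    positivity
  -- The uniform half gives 1/w ≤ 2ℓ, the other half q/w ≤ 2. No sample is needed to form the
  -- weights, hence `k₀ := 0`.
  have htest (q : FinDist ℓ) := exists_closeness_test (α := Fin ℓ) (k₀ := 0) (k := k) r rfl
    (fun _ i => (q i + 1 / (ℓ : ℝ)) / 2) hε hε1 (B := 80 * ℓ) (by positivity) hk (fun _ => hw q)
    (fun _ => by
      rw [← Finset.sum_div, Finset.sum_add_distrib, stdSimplex.sum_eq_one]
      simp only [Finset.sum_const, Finset.card_univ, Fintype.card_fin, nsmul_eq_mul]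
      rw [mul_one_div_cancel (by positivity)]
      norm_num)
    (fun _ i => by
      have := stdSimplex.zero_le q i
      calc 1 / ((q i + 1 / (ℓ : ℝ)) / 2) ≤ 1 / ((0 + 1 / (ℓ : ℝ)) / 2) := by gcongr
        _ = 2 * ℓ := by field_simp; norm_num
        _ ≤ 80 * ℓ := by linarith)
  choose A hA using htest
  -- As q is known, its sample is simulated: the acceptance probability at x is the average of the
  -- two-sample test over y drawn from q.
  have hprob (q : FinDist ℓ) (x : Fin (r * (0 + (k + k))) → Fin ℓ) :
      wmean (iidWeight _ q) (fun y => if A q x y then (1 : ℝ) else 0) ∈ unitInterval :=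
    ⟨wprob_nonneg (iidWeight_mem (FinDist.coe_mem q)) _, wprob_le_one (iidWeight_mem (FinDist.coe_mem q)) _⟩
  refine ⟨r * (0 + (k + k)), ?_, fun q x => ⟨_, hprob q x⟩, fun p _ q _ => ?_⟩
  · have h0 : 0 ≤ (ℓ : ℝ) ^ (1 / 2 : ℝ) * ε ^ (-2 : ℝ) := by positivity
    push_cast
    calc (r : ℝ) * (0 + (k + k)) ≤ (5 * Real.log (1 / δ)) *
          (0 + (12001 * ((ℓ : ℝ) ^ (1 / 2 : ℝ) * ε ^ (-2 : ℝ)) +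
            12001 * ((ℓ : ℝ) ^ (1 / 2 : ℝ) * ε ^ (-2 : ℝ)))) := by gcongr
      _ ≤ _ := by nlinarith [mul_nonneg h0 hlog0]
  · have hS : wmean (iidWeight (Fin 0) q)
        (fun _ => ∑ i, (q i / ((q i + 1 / (ℓ : ℝ)) / 2)) ^ 2) ≤ 80 * ℓ / 20 := by
      rw [wmean_const (iidWeight_mem (FinDist.coe_mem q))]
      calc ∑ i, (q i / ((q i + 1 / (ℓ : ℝ)) / 2)) ^ 2 ≤ ∑ _i : Fin ℓ, (4 : ℝ) := by
            refine Finset.sum_le_sum fun i _ => ?_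
            have h0 := stdSimplex.zero_le q i
            have h1 : q i / ((q i + 1 / (ℓ : ℝ)) / 2) ≤ 2 := by
              rw [div_le_iff₀ (hw q i)]
              have : 0 < 1 / (ℓ : ℝ) := by positivity
              linarith
            calc (q i / ((q i + 1 / (ℓ : ℝ)) / 2)) ^ 2 ≤ 2 ^ 2 :=
                  pow_le_pow_left₀ (div_nonneg h0 (hw q i).le) h1 2
              _ = 4 := by norm_num
        _ = 80 * ℓ / 20 := by
            simp only [Finset.sum_const, Finset.card_univ, Fintype.card_fin, nsmul_eq_mul]
            ring
    obtain ⟨h1, h2⟩ := hA q p (FinDist.coe_mem p) q (FinDist.coe_mem q) hS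
    rw [KnownTester.acceptProb_eq_wmean]
    refine ⟨fun hpq => ?_, fun hpq => ?_⟩
    · have := h1 (congrArg _ hpq)
      exact le_trans (by linarith) this
    · have := h2 (le_sum_abs_of_le_tvDist hpq)
      exact sub_le_sub_left (this.trans hr) 1

/-- The weights of `Fin ℓ` that are proportional to the counts in a sample, increased by one. -/
def countWeight {ℓ k₀ : ℕ} (y : Fin k₀ → Fin ℓ) (i : Fin ℓ) : ℝ :=
  (((Finset.univ.filter fun s => y s = i).card : ℝ) + 1) / (k₀ + ℓ)

theorem sum_countWeight {ℓ k₀ : ℕ} (hℓ : 1 ≤ ℓ) (y : Fin k₀ → Fin ℓ) :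
    ∑ i, countWeight y i = 1 := by
  have hℓ1 : (1 : ℝ) ≤ ℓ := by exact_mod_cast hℓ
  have h := Finset.card_eq_sum_card_fiberwise (f := y) (s := Finset.univ) (t := Finset.univ)
    fun _ _ => Finset.mem_coe.2 (Finset.mem_univ _)
  rw [Finset.card_univ, Fintype.card_fin] at h
  have h' : (∑ i, ((Finset.univ.filter fun s => y s = i).card : ℝ)) = k₀ := by exact_mod_cast h.symm
  unfold countWeight
  rw [← Finset.sum_div, Finset.sum_add_distrib, h']
  simp only [Finset.sum_const, Finset.card_univ, Fintype.card_fin, nsmul_eq_mul, mul_one]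
  exact div_self (by positivity)

/-- With N = 1/(count + 1) ≤ 1, (q i / w i)² is at most (k₀ + ℓ)² (q i)² N, and the mean of N is at
most 1/((k₀ + 1) q i) when q i > 0. One factor q i survives and sums to 1. -/
theorem wmean_sum_sq_div_countWeight_le {ℓ : ℕ} (q : FinDist ℓ) (k₀ : ℕ) :
    wmean (iidWeight (Fin k₀) q) (fun y => ∑ i, (q i / countWeight y i) ^ 2) ≤
      (k₀ + ℓ) ^ 2 / (k₀ + 1) := by
  classical
  set N : (Fin k₀ → Fin ℓ) → Fin ℓ → ℝ := fun y i =>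
    1 / (((Finset.univ.filter fun s => y s = i).card : ℝ) + 1) with hN
  have hle (y : Fin k₀ → Fin ℓ) : ∑ i, (q i / countWeight y i) ^ 2 ≤
      ∑ i, ((k₀ + ℓ) ^ 2 * q i ^ 2) * N y i := by
    refine Finset.sum_le_sum fun i _ => ?_
    have h0 : 0 ≤ N y i := by positivity
    have h1 : N y i ≤ 1 := by
      rw [hN]
      exact (div_le_one (by positivity)).2 (by
        have : (0 : ℝ) ≤ (Finset.univ.filter fun s => y s = i).card := Nat.cast_nonneg _
        linarith)
    have : q i / countWeight y i = (k₀ + ℓ) * q i * N y i := by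
      rw [countWeight, div_div_eq_mul_div, hN]
      ring
    rw [this]
    calc ((k₀ + ℓ) * q i * N y i) ^ 2 = ((k₀ + ℓ) ^ 2 * q i ^ 2) * (N y i * N y i) := by ring
      _ ≤ ((k₀ + ℓ) ^ 2 * q i ^ 2) * (1 * N y i) := by gcongr
      _ = _ := by rw [one_mul]
  refine (wmean_mono (iidWeight_mem (FinDist.coe_mem q)) hle).trans ?_
  rw [wmean_sum]
  simp only [wmean_const_mul]
  have hi (i : Fin ℓ) : ((k₀ + ℓ) ^ 2 * q i ^ 2) * wmean (iidWeight (Fin k₀) q) (fun y => N y i) ≤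
      (k₀ + ℓ) ^ 2 / (k₀ + 1) * q i := by
    have h := wmean_inv_count_add_one_le (FinDist.coe_mem q) (fun a => a = i) k₀
    have hq : wprob (q : Fin ℓ → ℝ) (fun a => a = i) = q i := by
      simp [wprob, wmean]
    rw [hq] at h
    have h' : (k₀ + 1) * q i * wmean (iidWeight (Fin k₀) q) (fun y => N y i) ≤ 1 := by
      convert h
    have h0 := stdSimplex.zero_le q i
    calc ((k₀ + ℓ) ^ 2 * q i ^ 2) * wmean (iidWeight (Fin k₀) q) (fun y => N y i)
        = (k₀ + ℓ) ^ 2 / (k₀ + 1) * q i *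
            ((k₀ + 1) * q i * wmean (iidWeight (Fin k₀) q) (fun y => N y i)) := by
          field_simp
      _ ≤ (k₀ + ℓ) ^ 2 / (k₀ + 1) * q i * 1 := by gcongr
      _ = _ := mul_one _
  refine (Finset.sum_le_sum fun i _ => hi i).trans_eq ?_
  rw [← Finset.mul_sum, stdSimplex.sum_eq_one, mul_one]

theorem exists_unknownTester {ℓ : ℕ} (hℓ : 1 ≤ ℓ) {ε δ : ℝ} (hε : 0 < ε) (hε1 : ε ≤ 1)
    (hδ : 0 < δ) (hδ1 : δ < 1) :
    ∃ m : ℕ, (m : ℝ) ≤ 130000 * ((ℓ : ℝ) ^ (2 / 3 : ℝ) * ε ^ (-2 : ℝ) * Real.log (1 / δ)) ∧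
      ∃ T : UnknownTester ℓ m, TestsIdentity T.acceptProb Set.univ (ε / 2) δ := by
  classical
  have hℓ1 : (1 : ℝ) ≤ ℓ := by exact_mod_cast hℓ
  have hlog0 : 0 ≤ Real.log (1 / δ) := Real.log_nonneg (by rw [le_div_iff₀ hδ]; linarith)
  rcases le_or_gt (1 / 2) δ with hδ2 | hδ2
  · refine ⟨0, by rw [Nat.cast_zero]; positivity, fun _ _ => halfAccept,
      testsIdentity_of_half_le (fun p q => ?_) _ _ hδ2⟩
    rw [UnknownTester.acceptProb_eq_wmean, wmean_const (iidWeight_mem (FinDist.coe_mem q)),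
      wmean_const (iidWeight_mem (FinDist.coe_mem p))]
    rfl
  obtain ⟨r, hr, hr'⟩ := exists_rounds hδ hδ2
  set X : ℝ := (ℓ : ℝ) ^ (2 / 3 : ℝ) with hX
  have hX1 : 1 ≤ X := Real.one_le_rpow hℓ1 (by norm_num)
  have hXℓ : X ≤ ℓ := by
    simpa using Real.rpow_le_rpow_of_exponent_le hℓ1 (show (2 / 3 : ℝ) ≤ 1 by norm_num)
  have hX3 : X ^ 3 = (ℓ : ℝ) ^ 2 := by
    rw [hX, ← Real.rpow_natCast, ← Real.rpow_mul (by positivity), ← Real.rpow_natCast]; norm_num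
  have hX2 : (ℓ : ℝ) ≤ X ^ 2 := by
    have : (ℓ : ℝ) ^ 2 ≤ ℓ * X ^ 2 := by
      rw [← hX3]; nlinarith [sq_nonneg X]
    nlinarith
  obtain ⟨k, hk, hk'⟩ := exists_batch_size hX1 hε hε1
  -- With k₀ ≤ ℓ, B is of order ℓ²/k₀ and the batch size of order ℓ/(√k₀ ε²); apart from ε, this
  -- balances k₀ at ℓ^(2/3).
  set k₀ : ℕ := ⌈X⌉₊ with hk₀
  have hk₀X : X ≤ k₀ := Nat.le_ceil X
  have hk₀X' : (k₀ : ℝ) < X + 1 := Nat.ceil_lt_add_one (by linarith)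
  have hk₀ℓ : (k₀ : ℝ) ≤ ℓ := by exact_mod_cast Nat.ceil_le.2 hXℓ
  have hw (y : Fin k₀ → Fin ℓ) (i : Fin ℓ) : 0 < countWeight y i := by
    unfold countWeight; positivity
  obtain ⟨A, hA⟩ := exists_closeness_test (α := Fin ℓ) (k₀ := k₀) (k := k) r rfl
    countWeight hε hε1 (B := 80 * X ^ 2) (by positivity) hk hw
    (fun y => (sum_countWeight hℓ y).le)
    (fun y i => by
      rw [countWeight, one_div_div]
      have hc : (1 : ℝ) ≤ ((Finset.univ.filter fun s => y s = i).card : ℝ) + 1 := by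
        have : (0 : ℝ) ≤ (Finset.univ.filter fun s => y s = i).card := Nat.cast_nonneg _
        linarith
      refine (div_le_self (by positivity) hc).trans ?_
      linarith [sq_nonneg X])
  refine ⟨r * (k₀ + (k + k)), ?_, fun x y => if A x y then 1 else 0, fun p _ q _ => ?_⟩
  · have hone : (1 : ℝ) ≤ ε ^ (-2 : ℝ) :=
      Real.one_le_rpow_of_pos_of_le_one_of_nonpos hε hε1 (by norm_num)
    have hX0 : X ≤ X * ε ^ (-2 : ℝ) := le_mul_of_one_le_right (by linarith) hone
    have h0 : 0 ≤ X * ε ^ (-2 : ℝ) := by positivity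
    have hsum : (k₀ : ℝ) + (k + k) ≤ 24004 * (X * ε ^ (-2 : ℝ)) := by linarith
    push_cast
    calc (r : ℝ) * (k₀ + (k + k)) ≤ (5 * Real.log (1 / δ)) * (24004 * (X * ε ^ (-2 : ℝ))) := by
          gcongr
      _ ≤ _ := by nlinarith [mul_nonneg h0 hlog0]
  · have hS : wmean (iidWeight (Fin k₀) q) (fun y => ∑ i, (q i / countWeight y i) ^ 2) ≤
        80 * X ^ 2 / 20 := by
      refine (wmean_sum_sq_div_countWeight_le q k₀).trans ?_
      rw [div_le_iff₀ (by positivity)]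
      calc ((k₀ : ℝ) + ℓ) ^ 2 ≤ (ℓ + ℓ) ^ 2 := by gcongr
        _ = 80 * X ^ 2 / 20 * X := by linear_combination -4 * hX3
        _ ≤ 80 * X ^ 2 / 20 * (k₀ + 1) := by gcongr; linarith
    obtain ⟨h1, h2⟩ := hA p (FinDist.coe_mem p) q (FinDist.coe_mem q) hS
    have hT (x y) : (((if A x y then 1 else 0 : unitInterval)) : ℝ) = if A x y then 1 else 0 := by
      split_ifs <;> rfl
    rw [UnknownTester.acceptProb_eq_wmean]
    simp only [hT]
    refine ⟨fun hpq => ?_, fun hpq => ?_⟩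
    · have := h1 (congrArg _ hpq)
      exact le_trans (by linarith) this
    · have := h2 (le_sum_abs_of_le_tvDist hpq)
      exact sub_le_sub_left (this.trans hr) 1

/-! ### Birgé's partition -/

section Birge

variable {κ : ℝ}

theorem birgeEnd_zero (κ : ℝ) : birgeEnd κ 0 = 0 := by simp [birgeEnd]

theorem birgeEnd_succ (κ : ℝ) (j : ℕ) :
    birgeEnd κ (j + 1) = birgeEnd κ j + ⌊(1 + κ) ^ (j + 1)⌋₊ :=
  Finset.sum_Icc_succ_top (by omega) _

theorem one_le_floor_pow (hκ : 0 ≤ κ) (j : ℕ) : 1 ≤ ⌊(1 + κ) ^ j⌋₊ := by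
  rw [Nat.one_le_floor_iff]
  exact one_le_pow₀ (by linarith)

theorem birgeEnd_strictMono (hκ : 0 ≤ κ) : StrictMono (birgeEnd κ) :=
  strictMono_nat_of_lt_succ fun j => by
    have := one_le_floor_pow hκ (j + 1)
    rw [birgeEnd_succ]; omega

theorem birgeEnd_birgeIndex_le (κ : ℝ) (i : ℕ) : birgeEnd κ (birgeIndex κ i) ≤ i :=
  Nat.findGreatest_spec (P := fun j => birgeEnd κ j ≤ i) (Nat.zero_le i)
    (by rw [birgeEnd_zero]; exact Nat.zero_le i)

theorem lt_birgeEnd_birgeIndex_succ (hκ : 0 ≤ κ) (i : ℕ) :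
    i < birgeEnd κ (birgeIndex κ i + 1) := by
  by_contra! h
  -- The search bound of `birgeIndex` is harmless because j ≤ birgeEnd κ j.
  have h1 := (birgeEnd_strictMono hκ).le_apply.trans h
  have h2 : birgeIndex κ i + 1 ≤ birgeIndex κ i :=
    Nat.le_findGreatest (P := fun j => birgeEnd κ j ≤ i) h1 h
  omega

theorem birgeIndex_eq_iff (hκ : 0 ≤ κ) (i j : ℕ) :
    birgeIndex κ i = j ↔ birgeEnd κ j ≤ i ∧ i < birgeEnd κ (j + 1) := by
  have h1 := birgeEnd_birgeIndex_le κ i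
  have h2 := lt_birgeEnd_birgeIndex_succ hκ i
  constructor
  · rintro rfl
    exact ⟨h1, h2⟩
  · rintro ⟨h3, h4⟩
    have h5 := (birgeEnd_strictMono hκ).lt_iff_lt.1 (h1.trans_lt h4)
    have h6 := (birgeEnd_strictMono hκ).lt_iff_lt.1 (h3.trans_lt h2)
    omega

theorem le_birgeEnd_birgeCount (hκ : 0 ≤ κ) (n : ℕ) : n ≤ birgeEnd κ (birgeCount κ n) := by
  have := lt_birgeEnd_birgeIndex_succ hκ (n - 1)
  unfold birgeCount
  omega

/-- The left side is κ times the geometric sum of the unrounded lengths, and rounding down loses at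
most a factor 2 on numbers that are at least 1. -/
theorem pow_sub_le_birgeEnd (hκ : 0 ≤ κ) (j : ℕ) :
    (1 + κ) ^ (j + 1) - (1 + κ) ≤ 2 * κ * birgeEnd κ j := by
  induction j with
  | zero => simp [birgeEnd_zero]
  | succ j ih =>
    have h1 : (1 : ℝ) ≤ ⌊(1 + κ) ^ (j + 1)⌋₊ := by exact_mod_cast one_le_floor_pow hκ (j + 1)
    have h2 := Nat.lt_floor_add_one ((1 + κ) ^ (j + 1))
    rw [birgeEnd_succ]
    push_cast
    have h3 : κ * (1 + κ) ^ (j + 1) ≤ κ * (2 * ⌊(1 + κ) ^ (j + 1)⌋₊) :=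
      mul_le_mul_of_nonneg_left (by linarith) hκ
    calc (1 + κ) ^ (j + 1 + 1) - (1 + κ)
        = ((1 + κ) ^ (j + 1) - (1 + κ)) + κ * (1 + κ) ^ (j + 1) := by ring
      _ ≤ _ := by linarith

/-- The additive term 1 + κ in `pow_sub_le_birgeEnd` is absorbed by a fixed fraction of the length;
this needs length at least 2 and fails for the initial singletons. -/
theorem floor_pow_le_birgeEnd (hκ : 0 ≤ κ) (hκ1 : κ ≤ 1 / 12) {j : ℕ}
    (hj : 2 ≤ ⌊(1 + κ) ^ (j + 1)⌋₊) :
    (⌊(1 + κ) ^ (j + 1)⌋₊ : ℝ) ≤ 6 * κ * birgeEnd κ j := by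
  have h0 : (2 : ℝ) ≤ ⌊(1 + κ) ^ (j + 1)⌋₊ := by exact_mod_cast hj
  have h1 := Nat.floor_le (show 0 ≤ (1 + κ) ^ (j + 1) by positivity)
  have h2 := pow_sub_le_birgeEnd hκ j
  linarith

/-- The number of intervals is `O(log (κ n + 1) / κ)`. -/
theorem birgeIndex_mul_log_le (hκ : 0 ≤ κ) {n : ℕ} (hn : 1 ≤ n) :
    birgeIndex κ (n - 1) * Real.log (1 + κ) ≤ Real.log (1 + 2 * κ * n) := by
  have h1 := pow_sub_le_birgeEnd hκ (birgeIndex κ (n - 1))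
  have h2 : (birgeEnd κ (birgeIndex κ (n - 1)) : ℝ) ≤ n := by
    exact_mod_cast (birgeEnd_birgeIndex_le κ (n - 1)).trans (Nat.sub_le n 1)
  rw [← Real.log_pow]
  refine Real.log_le_log (by positivity) ?_
  have h3 : (1 + κ) ^ (birgeIndex κ (n - 1) + 1) - (1 + κ) ≤ 2 * κ * n :=
    h1.trans (mul_le_mul_of_nonneg_left h2 (by linarith))
  rw [pow_succ] at h3
  have h4 : 0 ≤ 2 * κ * n := by positivity
  nlinarith

theorem birgeCount_le {ε : ℝ} (hε : 0 < ε) (hε1 : ε ≤ 1) {n : ℕ} (hn : 1 ≤ n) :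
    (birgeCount (1 / 12 * ε) n : ℝ) ≤ 26 * (Real.log (ε * n + 1) / ε) := by
  have hn1 : (1 : ℝ) ≤ n := by exact_mod_cast hn
  have h1 := birgeIndex_mul_log_le (κ := 1 / 12 * ε) (by positivity) hn
  have hlog (x : ℝ) (hx : 0 < x) (hx1 : x ≤ 1) : x / 2 ≤ Real.log (1 + x) := by
    have := Real.one_sub_inv_le_log_of_pos (show 0 < 1 + x by linarith)
    refine le_trans ?_ this
    have h : (1 + x) * (1 + x)⁻¹ = 1 := mul_inv_cancel₀ (by linarith)
    have hpos : 0 < (1 + x)⁻¹ := by positivity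
    nlinarith
  have h2 := hlog (1 / 12 * ε) (by positivity) (by linarith)
  have h3 : Real.log (1 + 2 * (1 / 12 * ε) * n) ≤ Real.log (ε * n + 1) :=
    Real.log_le_log (by positivity) (by nlinarith)
  have h4 : ε / 2 ≤ Real.log (ε * n + 1) :=
    (hlog ε hε hε1).trans (Real.log_le_log (by positivity) (by nlinarith))
  have h5 : (birgeIndex (1 / 12 * ε) (n - 1) : ℝ) * (1 / 12 * ε / 2) ≤ Real.log (ε * n + 1) :=
    (mul_le_mul_of_nonneg_left h2 (Nat.cast_nonneg _)).trans (h1.trans h3)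
  -- 24 comes from the index, and 2 from the extra interval, since 1 ≤ 2 log (εn + 1) / ε.
  rw [← mul_div_assoc, le_div_iff₀ hε, birgeCount]
  push_cast
  linarith

/-! ### Reduced distributions of non-increasing distributions -/

theorem stdSimplex_map_apply {n ℓ : ℕ} (b : Fin n → Fin ℓ) (p : FinDist n) (j : Fin ℓ) :
    stdSimplex.map b p j = ∑ i with b i = j, p i := by
  rw [stdSimplex.map_coe, FunOnFinite.linearMap_apply_apply]

/-- If `P` and `Q` are non-increasing, then on an interval the `ℓ¹` distance exceeds the
difference of the masses at most by the length times the total oscillation. -/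
theorem sum_abs_sub_le_abs_sum_sub_add {P Q : ℕ → ℝ} (hP : Antitone P) (hQ : Antitone Q)
    (a b : ℕ) :
    ∑ i ∈ Finset.Ico a b, |P i - Q i| ≤ |∑ i ∈ Finset.Ico a b, (P i - Q i)| +
      ((b - a : ℕ) : ℝ) * ((P a - P b) + (Q a - Q b)) := by
  rcases le_or_gt b a with hab | hab
  · simp [Finset.Ico_eq_empty_of_le hab, Nat.sub_eq_zero_of_le hab]
  have hosc : 0 ≤ (P a - P b) + (Q a - Q b) := by
    have := hP hab.le
    have := hQ hab.le
    linarith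
  have herr : 0 ≤ ((b - a : ℕ) : ℝ) * ((P a - P b) + (Q a - Q b)) := by positivity
  by_cases hpos : ∀ i ∈ Finset.Ico a b, 0 ≤ P i - Q i
  · rw [Finset.sum_congr rfl fun i hi => abs_of_nonneg (hpos i hi)]
    exact (le_abs_self _).trans (le_add_of_nonneg_right herr)
  by_cases hneg : ∀ i ∈ Finset.Ico a b, P i - Q i ≤ 0
  · rw [Finset.sum_congr rfl fun i hi => abs_of_nonpos (hneg i hi), Finset.sum_neg_distrib]
    exact (neg_le_abs _).trans (le_add_of_nonneg_right herr)
  push Not at hpos hneg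
  obtain ⟨s, hs, hs'⟩ := hpos
  obtain ⟨t, ht, ht'⟩ := hneg
  -- Both signs occur, so the ranges [P b, P a] and [Q b, Q a] meet, and two of their points differ
  -- by at most the sum of the lengths.
  have hi (i : ℕ) (hi : i ∈ Finset.Ico a b) : |P i - Q i| ≤ (P a - P b) + (Q a - Q b) := by
    have hbd (i : ℕ) (hi : i ∈ Finset.Ico a b) : P b ≤ P i ∧ P i ≤ P a ∧ Q b ≤ Q i ∧ Q i ≤ Q a := by
      rw [Finset.mem_Ico] at hi
      exact ⟨hP hi.2.le, hP hi.1, hQ hi.2.le, hQ hi.1⟩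
    have h1 := hbd i hi
    have h2 := hbd s hs
    have h3 := hbd t ht
    rw [abs_le]
    constructor <;> linarith
  refine (Finset.sum_le_card_nsmul _ _ _ hi).trans ?_
  rw [Nat.card_Ico, nsmul_eq_mul]
  exact le_add_of_nonneg_left (abs_nonneg _)

/-- Abel summation: each block has mass at least its length times the value at the first point of
the next block. Measuring oscillation up to that point makes the sum telescope. -/
theorem sum_mul_sub_add_le_sum_range {P : ℕ → ℝ} (hP : Antitone P) {e : ℕ → ℕ} (he : Monotone e)
    (N : ℕ) :
    ∑ j ∈ Finset.range N, (e j : ℝ) * (P (e j) - P (e (j + 1))) + e N * P (e N) ≤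
      ∑ i ∈ Finset.range (e N), P i := by
  induction N with
  | zero =>
    have := Finset.card_nsmul_le_sum (Finset.range (e 0)) P (P (e 0))
      fun i hi => hP (Finset.mem_range.1 hi).le
    simpa using this
  | succ N ih =>
    have h := Finset.card_nsmul_le_sum (Finset.Ico (e N) (e (N + 1))) P (P (e (N + 1)))
      fun i hi => hP (Finset.mem_Ico.1 hi).2.le
    rw [Nat.card_Ico, nsmul_eq_mul, Nat.cast_sub (he N.le_succ)] at h
    rw [Finset.sum_range_succ, ← Finset.sum_range_add_sum_Ico _ (he N.le_succ)]
    linarith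

theorem sum_range_sum_Ico {e : ℕ → ℕ} (he : Monotone e) (h0 : e 0 = 0) (f : ℕ → ℝ) (N : ℕ) :
    ∑ j ∈ Finset.range N, ∑ i ∈ Finset.Ico (e j) (e (j + 1)), f i =
      ∑ i ∈ Finset.range (e N), f i := by
  induction N with
  | zero => simp [h0]
  | succ N ih => rw [Finset.sum_range_succ, ih, Finset.sum_range_add_sum_Ico _ (he N.le_succ)]

/-- The extension by zero of a distribution to the natural numbers. -/
def extendZero {n : ℕ} (p : FinDist n) (i : ℕ) : ℝ := if h : i < n then p ⟨i, h⟩ else 0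

theorem extendZero_val {n : ℕ} (p : FinDist n) (i : Fin n) : extendZero p i = p i := by
  simp [extendZero]

theorem extendZero_of_le {n : ℕ} (p : FinDist n) {i : ℕ} (h : n ≤ i) : extendZero p i = 0 := by
  simp [extendZero, h]

theorem extendZero_nonneg {n : ℕ} (p : FinDist n) (i : ℕ) : 0 ≤ extendZero p i := by
  unfold extendZero
  split_ifs
  · exact stdSimplex.zero_le p _
  · exact le_rfl

/-- Since the extension stays monotone, the last interval, cut off at n, can be treated as a
complete one. -/
theorem extendZero_antitone {n : ℕ} {p : FinDist n} (hp : p ∈ nonIncreasing n) :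
    Antitone (extendZero p) := by
  intro i j hij
  rcases lt_or_ge j n with hj | hj
  · simp only [extendZero, hj, hij.trans_lt hj, dif_pos]
    exact hp (Fin.mk_le_mk.2 hij)
  · rw [extendZero_of_le p hj]
    exact extendZero_nonneg p i

theorem sum_extend_range {n N : ℕ} (hN : n ≤ N) {f : ℕ → ℝ} (hf : ∀ i, n ≤ i → f i = 0) :
    ∑ i ∈ Finset.range N, f i = ∑ i : Fin n, f i := by
  rw [Fin.sum_univ_eq_sum_range]
  refine (Finset.sum_subset (Finset.range_subset_range.2 hN) fun i _ hi => hf i ?_).symm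
  simpa using hi

theorem map_birgeMap_apply (hκ : 0 ≤ κ) {n : ℕ} (p : FinDist n) (j : Fin (birgeCount κ n)) :
    stdSimplex.map (birgeMap κ n) p j =
      ∑ i ∈ Finset.Ico (birgeEnd κ j) (birgeEnd κ (j + 1)), extendZero p i := by
  have hmem (i : ℕ) :
      i ∈ Finset.Ico (birgeEnd κ j) (birgeEnd κ (j + 1)) ↔ birgeIndex κ i = j := by
    rw [Finset.mem_Ico, birgeIndex_eq_iff hκ]
  rw [stdSimplex_map_apply, Finset.sum_filter]
  have h1 : ∑ i : Fin n, (if birgeMap κ n i = j then p i else 0) =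
      ∑ i : Fin n, (if birgeIndex κ (i : ℕ) = j then extendZero p (i : ℕ) else 0) := by
    refine Finset.sum_congr rfl fun i _ => ?_
    simp only [extendZero_val, Fin.ext_iff, birgeMap]
  rw [h1, ← sum_extend_range (le_max_left n (birgeEnd κ (j + 1)))
    (f := fun i => if birgeIndex κ i = j then extendZero p i else 0)
    (fun i hi => by simp [extendZero_of_le p hi]), ← Finset.sum_filter]
  refine Finset.sum_congr ?_ fun _ _ => rfl
  ext i
  rw [Finset.mem_filter, ← hmem, Finset.mem_range, Finset.mem_Ico, lt_max_iff]
  tauto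

theorem tvDist_le_tvDist_map_birgeMap (hκ : 0 ≤ κ) (hκ1 : κ ≤ 1 / 12) {n : ℕ} {p q : FinDist n}
    (hp : p ∈ nonIncreasing n) (hq : q ∈ nonIncreasing n) :
    tvDist p q ≤
      tvDist (stdSimplex.map (birgeMap κ n) p) (stdSimplex.map (birgeMap κ n) q) + 6 * κ := by
  set P := extendZero p with hPdef
  set Q := extendZero q with hQdef
  set e := birgeEnd κ with he
  set N := birgeCount κ n with hN
  have hP : Antitone P := extendZero_antitone hp
  have hQ : Antitone Q := extendZero_antitone hq
  have hmono : Monotone e := (birgeEnd_strictMono hκ).monotone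
  have hnN : n ≤ e N := le_birgeEnd_birgeCount hκ n
  have hmass (p : FinDist n) : ∑ i ∈ Finset.range (e N), extendZero p i = 1 := by
    rw [sum_extend_range hnN fun i hi => extendZero_of_le p hi]
    simp only [extendZero_val, stdSimplex.sum_eq_one]
  have htel (p : FinDist n) (hp : Antitone (extendZero p)) :
      ∑ j ∈ Finset.range N, (e j : ℝ) * (extendZero p (e j) - extendZero p (e (j + 1))) ≤ 1 := by
    have h := sum_mul_sub_add_le_sum_range hp hmono N
    rw [hmass] at h
    have : 0 ≤ (e N : ℝ) * extendZero p (e N) := mul_nonneg (Nat.cast_nonneg _)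
      (extendZero_nonneg p _)
    linarith
  have hint (j : ℕ) : ∑ i ∈ Finset.Ico (e j) (e (j + 1)), |P i - Q i| ≤
      |∑ i ∈ Finset.Ico (e j) (e (j + 1)), (P i - Q i)| +
        6 * κ * ((e j : ℝ) * (P (e j) - P (e (j + 1))) + e j * (Q (e j) - Q (e (j + 1)))) := by
    have hlen : e (j + 1) = e j + ⌊(1 + κ) ^ (j + 1)⌋₊ := birgeEnd_succ κ j
    have h1 := hP (hmono j.le_succ)
    have h2 := hQ (hmono j.le_succ)
    have hosc : 0 ≤ P (e j) - P (e (j + 1)) + (Q (e j) - Q (e (j + 1))) := by linarith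
    have hnn : 0 ≤ 6 * κ * ((e j : ℝ) * (P (e j) - P (e (j + 1))) +
        e j * (Q (e j) - Q (e (j + 1)))) := by
      rw [← mul_add]; positivity
    -- A singleton has no loss at all; longer intervals have length at most 6κ times what precedes
    -- them.
    rcases (one_le_floor_pow hκ (j + 1)).eq_or_lt with h | h
    · rw [hlen, ← h, Nat.Ico_succ_singleton, Finset.sum_singleton, Finset.sum_singleton]
      rw [hlen, ← h] at hnn
      linarith
    · refine (sum_abs_sub_le_abs_sum_sub_add hP hQ _ _).trans (add_le_add_right ?_ _)
      have hL := floor_pow_le_birgeEnd hκ hκ1 h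
      have hsub : e (j + 1) - e j = ⌊(1 + κ) ^ (j + 1)⌋₊ := by omega
      rw [hsub, ← mul_add, ← mul_assoc]
      exact mul_le_mul_of_nonneg_right hL hosc
  have hleft : ∑ i : Fin n, |p i - q i| =
      ∑ j ∈ Finset.range N, ∑ i ∈ Finset.Ico (e j) (e (j + 1)), |P i - Q i| := by
    rw [sum_range_sum_Ico hmono (birgeEnd_zero κ), sum_extend_range hnN fun i hi => by
      rw [hPdef, hQdef, extendZero_of_le p hi, extendZero_of_le q hi, sub_zero, abs_zero]]
    simp only [hPdef, hQdef, extendZero_val]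
  have hright : ∑ j : Fin N, |stdSimplex.map (birgeMap κ n) p j -
      stdSimplex.map (birgeMap κ n) q j| =
      ∑ j ∈ Finset.range N, |∑ i ∈ Finset.Ico (e j) (e (j + 1)), (P i - Q i)| := by
    rw [← Fin.sum_univ_eq_sum_range
      fun j => |∑ i ∈ Finset.Ico (e j) (e (j + 1)), (P i - Q i)|]
    refine Finset.sum_congr rfl fun j _ => ?_
    rw [map_birgeMap_apply hκ, map_birgeMap_apply hκ, Finset.sum_sub_distrib]
  have hsum := Finset.sum_le_sum fun j (_ : j ∈ Finset.range N) => hint j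
  rw [Finset.sum_add_distrib, ← Finset.mul_sum, Finset.sum_add_distrib] at hsum
  have hPtel := htel p hP
  have hQtel := htel q hQ
  unfold tvDist
  rw [hleft, hright]
  have := mul_le_mul_of_nonneg_left (add_le_add hPtel hQtel) (show 0 ≤ 6 * κ by positivity)
  linarith

end Birge

/-! ### Testing through a partition -/

/-- Expanding the product of the fibre sums shows that relabelled independent samples are
independent samples of the reduced distribution. -/
theorem wmean_iidWeight_map {n ℓ m : ℕ} (b : Fin n → Fin ℓ) (p : FinDist n)
    (F : (Fin m → Fin ℓ) → ℝ) :
    wmean (iidWeight (Fin m) p) (fun x => F (b ∘ x)) =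
      wmean (iidWeight (Fin m) (stdSimplex.map b p)) F := by
  classical
  unfold wmean iidWeight
  simp only [stdSimplex_map_apply, Finset.prod_univ_sum, Finset.sum_mul]
  rw [← Finset.sum_fiberwise Finset.univ fun x : Fin m → Fin n => b ∘ x]
  refine Finset.sum_congr rfl fun y _ => Finset.sum_congr ?_ fun x hx => ?_
  · ext x
    simp [Fintype.mem_piFinset, funext_iff]
  · rw [Fintype.mem_piFinset] at hx
    have : b ∘ x = y := funext fun k => (Finset.mem_filter.1 (hx k)).2
    rw [this]

theorem KnownTester.acceptProb_viaPartition {n ℓ m : ℕ} (b : Fin n → Fin ℓ) (T : KnownTester ℓ m)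
    (p q : FinDist n) :
    (T.viaPartition b).acceptProb p q =
      T.acceptProb (stdSimplex.map b p) (stdSimplex.map b q) :=
  wmean_iidWeight_map b p fun x => (T (stdSimplex.map b q) x : ℝ)

theorem UnknownTester.acceptProb_viaPartition {n ℓ m : ℕ} (b : Fin n → Fin ℓ)
    (T : UnknownTester ℓ m) (p q : FinDist n) :
    (T.viaPartition b).acceptProb p q =
      T.acceptProb (stdSimplex.map b p) (stdSimplex.map b q) := by
  rw [UnknownTester.acceptProb_eq_wmean, UnknownTester.acceptProb_eq_wmean,
    ← wmean_iidWeight_map b p]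
  refine congrArg _ (funext fun x => ?_)
  exact wmean_iidWeight_map b q fun y => (T (b ∘ x) y : ℝ)

theorem TestsIdentity.of_map_birgeMap {n : ℕ} {ε δ : ℝ} (hε : 0 < ε) (hε1 : ε ≤ 1)
    {acc : FinDist (birgeCount (1 / 12 * ε) n) → FinDist (birgeCount (1 / 12 * ε) n) → ℝ}
    (h : TestsIdentity acc Set.univ (ε / 2) δ) {acc' : FinDist n → FinDist n → ℝ}
    (hacc : ∀ p q, acc' p q = acc (stdSimplex.map (birgeMap (1 / 12 * ε) n) p)
      (stdSimplex.map (birgeMap (1 / 12 * ε) n) q)) :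
    TestsIdentity acc' (nonIncreasing n) ε δ := by
  intro p hp q hq
  rw [hacc]
  obtain ⟨h1, h2⟩ := h (stdSimplex.map (birgeMap (1 / 12 * ε) n) p) trivial
    (stdSimplex.map (birgeMap (1 / 12 * ε) n) q) trivial
  refine ⟨fun hpq => h1 (congrArg _ hpq), fun hpq => h2 ?_⟩
  have := tvDist_le_tvDist_map_birgeMap (κ := 1 / 12 * ε) (by positivity) (by linarith) hp hq
  linarith

end

/-! ### Numerical bounds and assembly -/

/-- The factor log log n is not needed by the tester, but for small n it must not shrink the bound
for known q by more than a constant; log 3 > 1.09 suffices. -/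
theorem log_log_lower {n : ℕ} (hn : 3 ≤ n) : 1 / 20 ≤ Real.log (Real.log n) := by
  have h3 : (3 : ℝ) ≤ n := by exact_mod_cast hn
  have hlog : (1.09 : ℝ) ≤ Real.log n := by
    refine le_trans ?_ (Real.log_le_log (by norm_num) h3)
    have h1 := Real.one_sub_inv_le_log_of_pos (show (0 : ℝ) < 3 / 2.7182818286 by norm_num)
    have h2 : (2.7182818286 : ℝ)⁻¹ < (Real.exp 1)⁻¹ :=
      inv_strictAnti₀ (Real.exp_pos 1) Real.exp_one_lt_d9
    have h3 : Real.log 3 = Real.log (3 / Real.exp 1) + 1 := by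
      rw [Real.log_div (by norm_num) (Real.exp_pos 1).ne', Real.log_exp]; ring
    have h4 : Real.log (3 / 2.7182818286) ≤ Real.log (3 / Real.exp 1) := by
      refine Real.log_le_log (by norm_num) ?_
      rw [div_eq_mul_inv, div_eq_mul_inv]
      linarith
    norm_num at h1 h4 ⊢
    linarith
  refine le_trans ?_ (Real.log_le_log (by norm_num) hlog)
  have := Real.one_sub_inv_le_log_of_pos (show (0 : ℝ) < 1.09 by norm_num)
  norm_num at this ⊢
  linarith

theorem birgeCount_rpow_le {n : ℕ} (hn : 3 ≤ n) {ε a : ℝ} (hε : 0 < ε) (hε1 : ε ≤ 1) (ha : 0 ≤ a)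
    (ha1 : a ≤ 1) :
    (birgeCount (1 / 12 * ε) n : ℝ) ^ a * ε ^ (-2 : ℝ) ≤
      52 * (Real.log n ^ a * ε ^ (-(2 + a))) := by
  have h3 : (3 : ℝ) ≤ n := by exact_mod_cast hn
  have hlogn : 0 ≤ Real.log n := Real.log_nonneg (by linarith)
  -- εn + 1 ≤ n².
  have hlog : Real.log (ε * n + 1) ≤ 2 * Real.log n := by
    rw [two_mul, ← Real.log_mul (by positivity) (by positivity)]
    exact Real.log_le_log (by positivity) (by nlinarith)
  have hcount : (birgeCount (1 / 12 * ε) n : ℝ) ≤ 52 * (Real.log n * ε⁻¹) := by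
    refine (birgeCount_le hε hε1 (by omega)).trans ?_
    rw [div_eq_mul_inv]
    have := mul_le_mul_of_nonneg_right hlog (inv_nonneg.2 hε.le)
    linarith
  have h52 : (52 : ℝ) ^ a ≤ 52 := by
    simpa using Real.rpow_le_rpow_of_exponent_le (show (1 : ℝ) ≤ 52 by norm_num) ha1
  have hle : (birgeCount (1 / 12 * ε) n : ℝ) ^ a ≤ 52 * (Real.log n ^ a * ε ^ (-a)) := by
    refine (Real.rpow_le_rpow (Nat.cast_nonneg _) hcount ha).trans ?_
    rw [Real.mul_rpow (by norm_num) (by positivity), Real.mul_rpow hlogn (by positivity),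
      Real.inv_rpow hε.le, ← Real.rpow_neg hε.le]
    exact mul_le_mul_of_nonneg_right h52 (by positivity)
  calc (birgeCount (1 / 12 * ε) n : ℝ) ^ a * ε ^ (-2 : ℝ)
      ≤ 52 * (Real.log n ^ a * ε ^ (-a)) * ε ^ (-2 : ℝ) :=
        mul_le_mul_of_nonneg_right hle (by positivity)
    _ = 52 * (Real.log n ^ a * (ε ^ (-a) * ε ^ (-2 : ℝ))) := by ring
    _ = 52 * (Real.log n ^ a * ε ^ (-(2 + a))) := by
        rw [← Real.rpow_add hε]
        congr 3
        ring

theorem mainTheorem1 :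
    ∃ c C : ℝ, 0 < c ∧ 0 < C ∧
      ∀ (n : ℕ) (ε δ : ℝ), 3 ≤ n → 0 < ε → ε ≤ 1 → 0 < δ → δ < 1 →
        -- the reduced domain is small
        (birgeCount (c * ε) n : ℝ) ≤ C * (Real.log (ε * n + 1) / ε) ∧
        -- testing identity, `q` is known
        (∃ m : ℕ,
          (m : ℝ) ≤ C * (Real.log n ^ (1 / 2 : ℝ) * Real.log (Real.log n) *
            ε ^ (-(5 / 2) : ℝ) * Real.log (1 / δ)) ∧
          ∃ T : KnownTester (birgeCount (c * ε) n) m,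
            TestsIdentity T.acceptProb Set.univ (ε / 2) δ ∧
            TestsIdentity (T.viaPartition (birgeMap (c * ε) n)).acceptProb
              (nonIncreasing n) ε δ) ∧
        -- testing identity, `q` is unknown
        (∃ m : ℕ,
          (m : ℝ) ≤ C * (Real.log n ^ (2 / 3 : ℝ) *
            (Real.log (Real.log n) + Real.log (1 / δ)) * ε ^ (-(10 / 3) : ℝ)) ∧
          ∃ T : UnknownTester (birgeCount (c * ε) n) m,
            TestsIdentity T.acceptProb Set.univ (ε / 2) δ ∧
            TestsIdentity (T.viaPartition (birgeMap (c * ε) n)).acceptProb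
              (nonIncreasing n) ε δ) := by
  -- 1/12 makes the loss 6κ equal to ε/2; the second constant exceeds 130000 · 52 · 20, where 20
  -- pays for log log n ≥ 1/20.
  refine ⟨1 / 12, 200000000, by norm_num, by norm_num, fun n ε δ hn hε hε1 hδ hδ1 => ?_⟩
  have h3 : (3 : ℝ) ≤ n := by exact_mod_cast hn
  have hlogn : 0 ≤ Real.log n := Real.log_nonneg (by linarith)
  have hll := log_log_lower hn
  have hlogδ : 0 ≤ Real.log (1 / δ) := Real.log_nonneg (by rw [le_div_iff₀ hδ]; linarith)
  have hcount : 1 ≤ birgeCount (1 / 12 * ε) n := Nat.succ_pos _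
  refine ⟨?_, ?_, ?_⟩
  · refine (birgeCount_le hε hε1 (by omega)).trans (mul_le_mul_of_nonneg_right (by norm_num) ?_)
    exact div_nonneg (Real.log_nonneg (by nlinarith)) hε.le
  · obtain ⟨m, hm, T, hT⟩ := exists_knownTester hcount hε hε1 hδ hδ1
    refine ⟨m, ?_, T, hT, hT.of_map_birgeMap hε hε1 (T.acceptProb_viaPartition _)⟩
    have h := birgeCount_rpow_le hn hε hε1 (a := 1 / 2) (by norm_num) (by norm_num)
    rw [show (-(2 + 1 / 2) : ℝ) = -(5 / 2) by norm_num] at h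
    set Y : ℝ := Real.log n ^ (1 / 2 : ℝ) * ε ^ (-(5 / 2) : ℝ) with hY
    have hY0 : 0 ≤ Y * Real.log (1 / δ) := by positivity
    calc (m : ℝ) ≤ 130000 * (52 * Y * Real.log (1 / δ)) := hm.trans (by gcongr)
      _ = 6760000 * (Y * Real.log (1 / δ)) := by ring
      _ ≤ 200000000 * (Y * Real.log (1 / δ) * Real.log (Real.log n)) := by
          linarith [mul_le_mul_of_nonneg_left hll hY0]
      _ = _ := by rw [hY]; ring
  · obtain ⟨m, hm, T, hT⟩ := exists_unknownTester hcount hε hε1 hδ hδ1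
    refine ⟨m, ?_, T, hT, hT.of_map_birgeMap hε hε1 (T.acceptProb_viaPartition _)⟩
    have h := birgeCount_rpow_le hn hε hε1 (a := 2 / 3) (by norm_num) (by norm_num)
    rw [show (-(2 + 2 / 3) : ℝ) = -(8 / 3) by norm_num] at h
    have hεle : ε ^ (-(8 / 3) : ℝ) ≤ ε ^ (-(10 / 3) : ℝ) :=
      Real.rpow_le_rpow_of_exponent_ge hε hε1 (by norm_num)
    calc (m : ℝ) ≤ 130000 * (52 * (Real.log n ^ (2 / 3 : ℝ) * ε ^ (-(8 / 3) : ℝ)) *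
          Real.log (1 / δ)) := hm.trans (by gcongr)
      _ ≤ 130000 * (52 * (Real.log n ^ (2 / 3 : ℝ) * ε ^ (-(10 / 3) : ℝ)) *
          (Real.log (Real.log n) + Real.log (1 / δ))) := by
          gcongr
          linarith
      _ = 6760000 * (Real.log n ^ (2 / 3 : ℝ) *
          (Real.log (Real.log n) + Real.log (1 / δ)) * ε ^ (-(10 / 3) : ℝ)) := by ring
      _ ≤ _ := by
          refine mul_le_mul_of_nonneg_right (by norm_num) ?_
          have : 0 ≤ Real.log (Real.log n) + Real.log (1 / δ) := by linarith
          positivity
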